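/- Let $V$ be a Euclidean vector space of dimension $n$ and $W\subset \mathrm O(V)$ a finite group generated by reflections that acts almost irreducibly: $V=V_1\oplus V_2$ with $W$-invariant subspaces such that $W$ acts irreducibly and nontrivially on $V_1$ and trivially on $V_2$, and $\dim V_2=1$. Let $V^*_{\mathbf C}=V^*\otimes_{\mathbf R}\mathbf C$, and write $\langle x,\phi\rangle$ for the pairing of $x\in V$ with $\phi\in V^*_{\mathbf C}$. Let $C=\{x\in V\mid \langle\sigma x,\phi_0\rangle\ge 0\text{ for all }\sigma\in W\}$ for a linear form $\phi_0\in V^*$ with $V_1,V_2\not\subset\ker\phi_0$. Let $F\subset V$ be a fundamental domain for $W$ (the closure of an open set, meeting every $W$-orbit in exactly one point), let $H_1,\dots,H_{n-1}$ be the facet hyperplanes of $F$ in some order, and let $s_j$ be the orthogonal reflection at $H_j$. For $\sigma\in W$ let $l(\sigma)$ be the length of a shortest expression of $\sigma$ as a product of the $s_j$, and let $\mathrm{Des}_R(\sigma)=\{j\in\{1,\dots,n-1\}\mid l(\sigma s_j)<l(\sigma)\}$. Let $\Gamma\subset V$ be a $W$-invariant lattice (of full rank), and suppose that $C_+=C\cap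 F$ is unimodular with respect to $\Gamma$, that is, generated as a cone by a basis of $\Gamma$, whose members are called the primitive generators of $C_+$. Then the primitive generators of $C_+$ can be enumerated as $b_1,\dots,b_n$ in exactly one way such that $b_j\notin H_j$ for $j=1,\dots,n-1$. Let $e_1,\dots,e_n$ be any basis of $\Gamma$, put $z_j(\phi)=e^{-\langle e_j,\phi\rangle}$ for $\phi\in V^*_{\mathbf C}$, and $z^a=z_1^{a_1}\cdots z_n^{a_n}$ for $a=a_1e_1+\cdots+a_ne_n\in\Gamma$. Let $f_C$ be the generating function of $C$ with respect to $\Gamma$, that is, the meromorphic function on $V^*_{\mathbf C}$ that on some nonempty open subset is the sum of the convergent series $\sum_{x\in C\cap\Gamma}e^{-\langle x,\phi\rangle}$. Then $f_C$ exists, and \[ f_C=\sum_{\sigma\in W}\frac{\prod_{j\in\mathrm{Des}_R(\sigma)}z^{\sigma b_j}}{(1-z^{\sigma b_1})\cdots(1-z^{\sigma b_n})}\,. \] -/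

import Mathlib

noncomputable section

namespace SymCone

variable {V : Type*} [NormedAddCommGroup V] [InnerProductSpace ℝ V] [FiniteDimensional ℝ V]

/-- A reflection of a Euclidean space: the orthogonal reflection at a hyperplane `vᗮ`, `v ≠ 0`. -/
def IsReflection (s : V ≃ₗᵢ[ℝ] V) : Prop :=
  ∃ v : V, v ≠ 0 ∧ s = (Submodule.span ℝ {v})ᗮ.reflection

/-- A reflection group: a subgroup of `O(V)` that is generated by the reflections it contains. -/
def IsReflectionGroup (W : Subgroup (V ≃ₗᵢ[ℝ] V)) : Prop :=
  Subgroup.closure {s | s ∈ W ∧ IsReflection s} = W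

/-- `W` acts almost irreducibly on `V`, with decomposition `V = V₁ ⊕ V₂`: the subspaces are
`W`-invariant, the action on `V₁` is irreducible and nontrivial, the action on `V₂` is trivial
(so that `V₂` is invariant), and `V₂` is one-dimensional. -/
structure IsAlmostIrreducible (W : Subgroup (V ≃ₗᵢ[ℝ] V)) (V₁ V₂ : Submodule ℝ V) : Prop where
  isCompl : IsCompl V₁ V₂
  invariant : ∀ σ ∈ W, ∀ x ∈ V₁, σ x ∈ V₁
  irreducible : ∀ U : Submodule ℝ V, U ≤ V₁ → (∀ σ ∈ W, ∀ x ∈ U, σ x ∈ U) → U = ⊥ ∨ U = V₁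
  nontrivial : ∃ σ ∈ W, ∃ x ∈ V₁, σ x ≠ x
  trivial : ∀ σ ∈ W, ∀ x ∈ V₂, σ x = x
  finrank_eq_one : Module.finrank ℝ V₂ = 1

/-- A fundamental domain for `W`: the closure of an open set that meets every `W`-orbit in
exactly one point. -/
def IsFundamentalDomain (W : Subgroup (V ≃ₗᵢ[ℝ] V)) (F : Set V) : Prop :=
  (∃ U : Set V, IsOpen U ∧ F = closure U) ∧
    ∀ x : V, ∃! y : V, y ∈ F ∧ ∃ σ ∈ W, σ x = y

/-- `H` is a facet hyperplane of the (full-dimensional, polyhedral) cone `F`: it is the kernel of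
a nonzero linear form that is nonnegative on `F`, and it is spanned by `F ∩ H`. -/
def IsFacetHyperplane (F : Set V) (H : Submodule ℝ V) : Prop :=
  (∃ ψ : Module.Dual ℝ V, ψ ≠ 0 ∧ LinearMap.ker ψ = H ∧ ∀ x ∈ F, 0 ≤ ψ x) ∧
    Submodule.span ℝ (F ∩ (H : Set V)) = H

/-- A monoconditional symmetric cone, for `W` acting on `V = V₁ ⊕ V₂`. (A set of this form is
a `W`-invariant convex cone, and it is polyhedral when `W` is finite.) -/
def IsMonoconditional (W : Subgroup (V ≃ₗᵢ[ℝ] V)) (V₁ V₂ : Submodule ℝ V) (C : Set V) : Prop :=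
  ∃ φ : Module.Dual ℝ V, ¬ V₁ ≤ LinearMap.ker φ ∧ ¬ V₂ ≤ LinearMap.ker φ ∧
    C = {x | ∀ σ ∈ W, 0 ≤ φ (σ x)}

/-- The length of `σ` with respect to the generators `s`: the least length of a word in the
`s j` with product `σ`. -/
def length {G : Type*} [Group G] {r : ℕ} (s : Fin r → G) (σ : G) : ℕ :=
  sInf {k | ∃ w : List (Fin r), w.length = k ∧ (w.map s).prod = σ}

/-- The right descent set of `σ` with respect to the generators `s`. -/
def rightDescents {G : Type*} [Group G] {r : ℕ} (s : Fin r → G) (σ : G) : Finset (Fin r) :=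
  Finset.univ.filter fun j => length s (σ * s j) < length s σ

/-- The cone `K` is generated by the basis `b` of the lattice `Γ`; then `K` is unimodular with
respect to `Γ`, and the `b i` are its primitive generators. -/
def IsGeneratedBy {Γ : Submodule ℤ V} {κ : Type*} [Fintype κ] (K : Set V)
    (b : Module.Basis κ ℤ Γ) : Prop :=
  K = {x | ∃ c : κ → ℝ, (∀ i, 0 ≤ c i) ∧ x = ∑ i, c i • (b i : V)}

/-- The cone `K` is unimodular with respect to `Γ`: it is generated by a basis of `Γ`. -/
def IsUnimodular (Γ : Submodule ℤ V) (K : Set V) : Prop :=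
  ∃ b : Module.Basis (Fin (Module.finrank ℝ V)) ℤ Γ, IsGeneratedBy K b

/-- Meromorphic functions on a complex vector space: locally quotients `p / q` of holomorphic
functions, where `q` does not vanish identically on any nonempty open subset. The value of `f`
at the zeros of `q` is irrelevant. -/
def IsMeromorphic {E : Type*} [NormedAddCommGroup E] [NormedSpace ℂ E] (f : E → ℂ) : Prop :=
  ∀ x : E, ∃ U : Set E, IsOpen U ∧ x ∈ U ∧ ∃ p q : E → ℂ,
    AnalyticOnNhd ℂ p U ∧ AnalyticOnNhd ℂ q U ∧ U ⊆ closure {y | y ∈ U ∧ q y ≠ 0} ∧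
      ∀ y ∈ U, q y ≠ 0 → f y = p y / q y

/-- `f` is the generating function of `S` with respect to `Γ`: a meromorphic function on the
complexified dual space of `V`, here the space `V →L[ℝ] ℂ` with pairing `⟨x, φ⟩ = φ x`, that on
some nonempty open set is the sum of the convergent series `∑ x ∈ S ∩ Γ, exp (-⟨x, φ⟩)`. -/
def IsGeneratingFunction (Γ : Submodule ℤ V) (S : Set V) (f : (V →L[ℝ] ℂ) → ℂ) : Prop :=
  IsMeromorphic f ∧ ∃ B : Set (V →L[ℝ] ℂ), IsOpen B ∧ B.Nonempty ∧
    ∀ φ ∈ B, HasSum (fun x : ↥(S ∩ (Γ : Set V)) => Complex.exp (-φ (x : V))) (f φ)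

/-- The coordinates `z_i(φ) = exp (-⟨e_i, φ⟩)` attached to a basis `e` of `Γ`. -/
def coord {Γ : Submodule ℤ V} {ι : Type*} (e : Module.Basis ι ℤ Γ) (i : ι)
    (φ : V →L[ℝ] ℂ) : ℂ :=
  Complex.exp (-φ (e i : V))

/-- The monomial `z^a = ∏ z_i ^ a_i`, where `a = ∑ a_i e_i ∈ Γ` with `a_i ∈ ℤ`. -/
def monomial {Γ : Submodule ℤ V} {ι : Type*} [Fintype ι] (e : Module.Basis ι ℤ Γ) (a : Γ)
    (φ : V →L[ℝ] ℂ) : ℂ :=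
  ∏ i, coord e i φ ^ (e.repr a i)

end SymCone

end

/-! Convexity of `F` comes from a metric argument. The retraction of `V` onto `F` along orbits does
not increase lengths of paths, so `‖y - x‖ ≤ ‖σ y - x‖` for `x`, `y` in `F`. Hence `⟪x, σ y⟫ ≤ ⟪x,
y⟫`, and `F` is the Dirichlet domain of any of its interior points `p` (`mem_iff`).

Adding multiples of a vector of `V₂` turns `C ∩ F` into `F`. As `C ∩ F` is simplicial and `V₂` is a
line, `F` is cut out by all but one of the coordinates of the generators (`exists_fixed_generator`).
Facets thus correspond to the generators outside `V₂`, which yields the enumeration; integrality and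
positivity make it unique (`enumeration_unique`).

The reflections at the walls lie in `W` (`reflectionAt_mem`), and their unit normals `α j` behave
like simple roots. Length counts inversions, so `j` is a right descent of `σ` iff `σ (α j)` is
negative at `p` (`mem_rightDescents_iff`). For given `x`, exactly one `σ` has `x + t p ∈ σ F` for
all small `t > 0`; it is the only `σ` for which `σ⁻¹ x` lies in `F` but on no descent wall
(`existsUnique_mem`).

For `x ∈ C ∩ Γ` this says that `σ⁻¹ x` has natural coordinates that are positive at the descents. So
`C ∩ Γ` is a disjoint union, over `σ ∈ W`, of translated free monoids (`bijective_decomposition`),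
and the geometric series of each is one summand. All series converge on a common open set because
the mean of the form defining `C` over `W` is positive on `C` outside `0` (`exists_invariant_pos`).
-/

section

open scoped InnerProductSpace
open Filter Topology Set

namespace SymCone

variable {V : Type*} [NormedAddCommGroup V] [InnerProductSpace ℝ V]

/-! ### Convexity of fundamental domains of finite groups -/

namespace IsFundamentalDomain

variable {W : Subgroup (V ≃ₗᵢ[ℝ] V)} {F : Set V}

lemma isClosed (hF : IsFundamentalDomain W F) : IsClosed F := by
  obtain ⟨⟨U, -, rfl⟩, -⟩ := hF
  exact isClosed_closure

lemma exists_mem (hF : IsFundamentalDomain W F) (x : V) : ∃ σ ∈ W, σ x ∈ F := by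
  obtain ⟨y, ⟨hy, σ, hσ, rfl⟩, -⟩ := hF.2 x
  exact ⟨σ, hσ, hy⟩

lemma apply_eq_apply (hF : IsFundamentalDomain W F) {x : V} {σ τ : V ≃ₗᵢ[ℝ] V} (hσ : σ ∈ W)
    (hτ : τ ∈ W) (h₁ : σ x ∈ F) (h₂ : τ x ∈ F) : σ x = τ x :=
  (hF.2 x).unique ⟨h₁, σ, hσ, rfl⟩ ⟨h₂, τ, hτ, rfl⟩

lemma apply_eq_self (hF : IsFundamentalDomain W F) {x : V} {σ : V ≃ₗᵢ[ℝ] V} (hσ : σ ∈ W)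
    (hx : x ∈ F) (h : σ x ∈ F) : σ x = x :=
  hF.apply_eq_apply (τ := 1) hσ W.one_mem h hx

/-- The retraction of the space onto a fundamental domain along the orbits. -/
noncomputable def retract (hF : IsFundamentalDomain W F) (x : V) : V := (hF.2 x).choose

lemma retract_eq (hF : IsFundamentalDomain W F) {x : V} {σ : V ≃ₗᵢ[ℝ] V} (hσ : σ ∈ W)
    (h : σ x ∈ F) : hF.retract x = σ x :=
  (hF.2 x).unique (hF.2 x).choose_spec.1 ⟨h, σ, hσ, rfl⟩

/-- As `F` is closed and `W` finite, any `σ` that takes a point `y` close to `x` into `F` also takes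
`x` there. One isometry then computes both retractions. -/
lemma eventually_norm_retract_sub [Finite W] (hF : IsFundamentalDomain W F) (x : V) :
    ∀ᶠ y in 𝓝 x, ‖hF.retract y - hF.retract x‖ = ‖y - x‖ := by
  have h : ∀ σ : W, ∀ᶠ y in 𝓝 x, (σ : V ≃ₗᵢ[ℝ] V) y ∈ F → (σ : V ≃ₗᵢ[ℝ] V) x ∈ F := by
    intro σ
    by_cases hx : (σ : V ≃ₗᵢ[ℝ] V) x ∈ F
    · exact Eventually.of_forall fun _ _ => hx
    · have := ((σ : V ≃ₗᵢ[ℝ] V).continuous.tendsto x).eventually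
        (hF.isClosed.isOpen_compl.mem_nhds hx)
      filter_upwards [this] with y hy hy' using absurd hy' hy
  filter_upwards [eventually_all.2 h] with y hy
  obtain ⟨σ, hσ, hσy⟩ := hF.exists_mem y
  rw [hF.retract_eq hσ hσy, hF.retract_eq hσ (hy ⟨σ, hσ⟩ hσy), ← map_sub, σ.norm_map]

lemma continuous_retract [Finite W] (hF : IsFundamentalDomain W F) :
    Continuous hF.retract := by
  refine continuous_iff_continuousAt.2 fun x => ?_
  refine tendsto_iff_norm_sub_tendsto_zero.2 ?_
  have h0 : Tendsto (fun y => ‖y - x‖) (𝓝 x) (𝓝 0) :=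
    tendsto_iff_norm_sub_tendsto_zero.1 tendsto_id
  refine h0.congr' ?_
  filter_upwards [hF.eventually_norm_retract_sub x] with y hy using hy.symm

/-- Retracting the segment from `x` to `σ y` gives a path in `F` from `x` to `y` of no greater
speed. A mean value inequality for right slopes bounds the distance of its ends. -/
lemma norm_sub_le_norm_sub_apply [Finite W] (hF : IsFundamentalDomain W F) {x y : V}
    {σ : V ≃ₗᵢ[ℝ] V} (hσ : σ ∈ W) (hx : x ∈ F) (hy : y ∈ F) : ‖y - x‖ ≤ ‖σ y - x‖ := by
  set γ : ℝ → V := fun t => x + t • (σ y - x) with hγ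
  have hγc : Continuous γ := by fun_prop
  have key := image_le_of_liminf_slope_right_le_deriv_boundary
    (f := fun t => ‖hF.retract (γ t) - x‖) (a := 0) (b := 1)
    (B := fun t => t * ‖σ y - x‖) (B' := fun _ => ‖σ y - x‖)
    ((((hF.continuous_retract.comp hγc).sub continuous_const).norm).continuousOn)
    (by simp [hγ, hF.retract_eq W.one_mem (x := x) hx])
    (by fun_prop)
    (fun t _ => by simpa using ((hasDerivAt_id t).mul_const ‖σ y - x‖).hasDerivWithinAt)
    (fun t _ ρ hρ => by
      refine Eventually.frequently ?_
      have h1 : ∀ᶠ z in 𝓝[>] t, ‖hF.retract (γ z) - hF.retract (γ t)‖ = ‖γ z - γ t‖ :=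
        ((hγc.tendsto t).mono_left nhdsWithin_le_nhds).eventually
          (hF.eventually_norm_retract_sub (γ t))
      filter_upwards [h1, self_mem_nhdsWithin] with z hz hzt
      have hzt' : 0 < z - t := sub_pos.2 hzt
      have h2 : γ z - γ t = (z - t) • (σ y - x) := by simp only [hγ, sub_smul]; abel
      rw [h2, norm_smul, Real.norm_of_nonneg hzt'.le] at hz
      refine lt_of_le_of_lt ?_ hρ
      rw [slope_def_field, div_le_iff₀ hzt', mul_comm, ← hz]
      refine (norm_sub_norm_le _ _).trans (le_of_eq ?_)
      congr 1; abel)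
  have h1 := key (x := 1) (by simp)
  have h2 : hF.retract (γ 1) = y := by
    have e1 : γ 1 = σ y := by simp [hγ]
    have e2 : σ⁻¹ (σ y) = y := σ.symm_apply_apply y
    rw [e1, hF.retract_eq (W.inv_mem hσ) (by rwa [e2]), e2]
  simpa [h2] using h1

lemma inner_apply_le [Finite W] (hF : IsFundamentalDomain W F) {x y : V}
    {σ : V ≃ₗᵢ[ℝ] V} (hσ : σ ∈ W) (hx : x ∈ F) (hy : y ∈ F) : ⟪x, σ y⟫_ℝ ≤ ⟪x, y⟫_ℝ := by
  have h := hF.norm_sub_le_norm_sub_apply hσ hx hy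
  have h2 := pow_le_pow_left₀ (norm_nonneg _) h 2
  rw [@norm_sub_sq_real, @norm_sub_sq_real, σ.norm_map] at h2
  rw [real_inner_comm, real_inner_comm y x]
  linarith

lemma interior_nonempty (hF : IsFundamentalDomain W F) : (interior F).Nonempty := by
  obtain ⟨σ, hσ, h⟩ := hF.exists_mem 0
  obtain ⟨⟨U, hU, rfl⟩, -⟩ := hF
  have : U.Nonempty := closure_nonempty_iff.1 ⟨_, h⟩
  exact this.mono (interior_maximal subset_closure hU)

/-- A linear functional that is nonnegative on a set and vanishes at an interior point is zero. -/
lemma _root_.SymCone.eq_zero_of_inner_nonneg {F : Set V} {p u : V} (hp : p ∈ interior F)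
    (h : ∀ x ∈ F, 0 ≤ ⟪u, x⟫_ℝ) (h0 : ⟪u, p⟫_ℝ = 0) : u = 0 := by
  have hc : Tendsto (fun t : ℝ => p - t • u) (𝓝[>] 0) (𝓝 p) := by
    have : Continuous fun t : ℝ => p - t • u := by fun_prop
    simpa using (this.tendsto 0).mono_left nhdsWithin_le_nhds
  have h1 := hc.eventually (mem_interior_iff_mem_nhds.1 hp)
  obtain ⟨t, ht, ht0⟩ := (h1.and self_mem_nhdsWithin).exists
  have h2 := h _ ht
  rw [inner_sub_right, h0, inner_smul_right] at h2
  have h3 : 0 ≤ ⟪u, u⟫_ℝ := real_inner_self_nonneg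
  have h4 : ⟪u, u⟫_ℝ = 0 := by
    have : (0:ℝ) < t := ht0
    nlinarith
  exact inner_self_eq_zero.1 h4

/-- The vector `x - σ⁻¹ x` is nonnegative on `F` by `inner_apply_le`; equality at the interior point
`p` forces it to vanish. -/
lemma apply_eq_self_of_inner_eq [Finite W] (hF : IsFundamentalDomain W F) {p x : V}
    (hp : p ∈ interior F) (hx : x ∈ F) {σ : V ≃ₗᵢ[ℝ] V} (hσ : σ ∈ W)
    (h : ⟪x, σ p⟫_ℝ = ⟪x, p⟫_ℝ) : σ x = x := by
  have key : ∀ y, ⟪x - σ⁻¹ x, y⟫_ℝ = ⟪x, y⟫_ℝ - ⟪x, σ y⟫_ℝ := by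
    intro y
    rw [inner_sub_left]
    congr 1
    rw [← σ.inner_map_map]
    exact congrArg (⟪·, σ y⟫_ℝ) (σ.apply_symm_apply x)
  have := eq_zero_of_inner_nonneg hp (u := x - σ⁻¹ x)
    (fun y hy => by rw [key]; exact sub_nonneg.2 (hF.inner_apply_le hσ hx hy))
    (by rw [key, h, sub_self])
  have h2 : x = σ⁻¹ x := sub_eq_zero.1 this
  conv_lhs => rw [h2]
  exact σ.apply_symm_apply x

lemma eq_one_of_apply_eq [Finite W] (hF : IsFundamentalDomain W F) {p : V}
    (hp : p ∈ interior F) {σ : V ≃ₗᵢ[ℝ] V} (hσ : σ ∈ W) (h : σ p = p) : σ = 1 := by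
  have h1 : ∀ x ∈ F, σ x = x := fun x hx => hF.apply_eq_self_of_inner_eq hp hx hσ (by rw [h])
  ext x
  change σ x = x
  have hc : Tendsto (fun t : ℝ => p + t • x) (𝓝[>] 0) (𝓝 p) := by
    have : Continuous fun t : ℝ => p + t • x := by fun_prop
    simpa using (this.tendsto 0).mono_left nhdsWithin_le_nhds
  have h2 := hc.eventually (mem_interior_iff_mem_nhds.1 hp)
  obtain ⟨t, ht, ht0⟩ := (h2.and self_mem_nhdsWithin).exists
  have h3 := h1 _ ht
  rw [map_add, map_smul, h] at h3
  exact smul_right_injective V (ne_of_gt ht0 : t ≠ 0) (add_left_cancel h3)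

/-- If `σ x ∈ F` with `σ ≠ 1`, then `inner_apply_le` for `σ x` and `p` contradicts the hypothesis at
`σ⁻¹`. -/
lemma mem_of_inner_lt [Finite W] (hF : IsFundamentalDomain W F) {p x : V}
    (hp : p ∈ interior F) (h : ∀ σ ∈ W, σ ≠ 1 → ⟪x, σ p⟫_ℝ < ⟪x, p⟫_ℝ) : x ∈ F := by
  obtain ⟨σ, hσ, hx⟩ := hF.exists_mem x
  have h1 := hF.inner_apply_le (W.inv_mem (W.inv_mem hσ)) hx (interior_subset hp)
  by_cases hs : σ = 1
  · subst hs; exact hx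
  · have h2 := h _ (W.inv_mem hσ) (by simpa using hs)
    have e1 : ⟪σ x, σ⁻¹⁻¹ p⟫_ℝ = ⟪x, p⟫_ℝ := by rw [inv_inv, σ.inner_map_map]
    have e2 : ⟪σ x, p⟫_ℝ = ⟪x, σ⁻¹ p⟫_ℝ := by
      rw [← σ.inner_map_map x]
      exact congrArg (⟪σ x, ·⟫_ℝ) (σ.apply_symm_apply p).symm
    rw [e1, e2] at h1
    exact absurd h2 (not_lt.2 h1)

lemma mem_iff [Finite W] (hF : IsFundamentalDomain W F) {p x : V}
    (hp : p ∈ interior F) : x ∈ F ↔ ∀ σ ∈ W, ⟪x, σ p⟫_ℝ ≤ ⟪x, p⟫_ℝ := by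
  refine ⟨fun hx σ hσ => hF.inner_apply_le hσ hx (interior_subset hp), fun h => ?_⟩
  -- Weak inequalities at `x` become strict at `x + t p`, since `p` has trivial stabilizer;
  -- closedness of `F` then gives `x`.
  have hc : Tendsto (fun t : ℝ => x + t • p) (𝓝[>] 0) (𝓝 x) := by
    have : Continuous fun t : ℝ => x + t • p := by fun_prop
    simpa using (this.tendsto 0).mono_left nhdsWithin_le_nhds
  refine hF.isClosed.mem_of_tendsto hc ?_
  filter_upwards [self_mem_nhdsWithin] with t ht
  refine hF.mem_of_inner_lt hp fun σ hσ hs => ?_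
  have h1 : ⟪p, σ p⟫_ℝ < ⟪p, p⟫_ℝ := by
    refine lt_of_le_of_ne (hF.inner_apply_le hσ (interior_subset hp) (interior_subset hp)) ?_
    intro h2
    exact hs (hF.eq_one_of_apply_eq hp hσ
      (hF.apply_eq_self_of_inner_eq hp (interior_subset hp) hσ h2))
  simp only [inner_add_left, inner_smul_left]
  have := h σ hσ
  have ht' : (0:ℝ) < t := ht
  have := mul_lt_mul_of_pos_left h1 ht'
  simp only [RCLike.conj_to_real]
  linarith

lemma add_mem_of_fixed [Finite W] (hF : IsFundamentalDomain W F) {x v : V}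
    (hx : x ∈ F) (hv : ∀ σ ∈ W, σ v = v) : x + v ∈ F := by
  obtain ⟨p, hp⟩ := hF.interior_nonempty
  rw [hF.mem_iff hp] at hx ⊢
  intro σ hσ
  have e : ⟪v, σ p⟫_ℝ = ⟪v, p⟫_ℝ := by
    conv_lhs => rw [← hv σ hσ]
    exact σ.inner_map_map _ _
  simp only [inner_add_left, e]
  linarith [hx σ hσ]

lemma zero_mem (hF : IsFundamentalDomain W F) : (0 : V) ∈ F := by
  obtain ⟨σ, hσ, h⟩ := hF.exists_mem 0
  simpa using h

lemma mem_of_fixed [Finite W] (hF : IsFundamentalDomain W F) {v : V}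
    (hv : ∀ σ ∈ W, σ v = v) : v ∈ F := by
  simpa using hF.add_mem_of_fixed hF.zero_mem hv

lemma fixed_of_mem_of_neg_mem [Finite W] (hF : IsFundamentalDomain W F) {x : V}
    (hx : x ∈ F) (hx' : -x ∈ F) {σ : V ≃ₗᵢ[ℝ] V} (hσ : σ ∈ W) : σ x = x := by
  obtain ⟨p, hp⟩ := hF.interior_nonempty
  refine hF.apply_eq_self_of_inner_eq hp hx hσ (le_antisymm
    (hF.inner_apply_le hσ hx (interior_subset hp)) ?_)
  have := hF.inner_apply_le hσ hx' (interior_subset hp)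
  simp only [inner_neg_left] at this
  linarith

end IsFundamentalDomain

end SymCone

/-! ### Facets of a cone cut out by all but one coordinate of a basis -/

namespace SymCone

section Facets

variable {V : Type*} [AddCommGroup V] [Module ℝ V] {κ : Type*} [DecidableEq κ]
  (B : Module.Basis κ ℝ V) {F : Set V} {o : κ}

lemma basis_mem_of_mem_iff (hF : ∀ x, x ∈ F ↔ ∀ i, i ≠ o → 0 ≤ B.repr x i) (i : κ) : B i ∈ F := by
  rw [hF]
  intro k _
  rw [B.repr_self, Finsupp.single_apply]
  split_ifs <;> norm_num

lemma ker_coord_injective : Function.Injective fun i => LinearMap.ker (B.coord i) := by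
  intro i k h
  by_contra hik
  have h1 : B i ∈ LinearMap.ker (B.coord k) := by
    rw [LinearMap.mem_ker, B.coord_apply, B.repr_self, Finsupp.single_eq_of_ne (Ne.symm hik)]
  have h2 : B i ∈ LinearMap.ker (B.coord i) := by
    have h' : LinearMap.ker (B.coord i) = LinearMap.ker (B.coord k) := h
    rwa [h']
  simp at h2

end Facets

variable {V : Type*} [NormedAddCommGroup V] [InnerProductSpace ℝ V]

/-- The facet hyperplanes of a cone cut out by all but one of the coordinates of a basis are the
kernels of these coordinates. -/
lemma isFacetHyperplane_iff {κ : Type*} [Fintype κ] [DecidableEq κ] (B : Module.Basis κ ℝ V)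
    {F : Set V} {o : κ} (hF : ∀ x, x ∈ F ↔ ∀ i, i ≠ o → 0 ≤ B.repr x i) (K : Submodule ℝ V) :
    IsFacetHyperplane F K ↔ ∃ i, i ≠ o ∧ K = LinearMap.ker (B.coord i) := by
  constructor
  · rintro ⟨⟨ψ, hψ, rfl, hψF⟩, hspan⟩
    have ha : ∀ i, 0 ≤ ψ (B i) := fun i => hψF _ (basis_mem_of_mem_iff B hF i)
    have hao : ψ (B o) = 0 := by
      refine le_antisymm ?_ (ha o)
      have : -B o ∈ F := by
        rw [hF]
        intro i hi
        rw [map_neg, B.repr_self, Finsupp.neg_apply, Finsupp.single_eq_of_ne hi, neg_zero]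
      have := hψF _ this
      rw [map_neg] at this
      linarith
    obtain ⟨i, hi⟩ : ∃ i, ψ (B i) ≠ 0 := by
      by_contra! h
      exact hψ (B.ext fun i => by simp [h i])
    have hio : i ≠ o := by rintro rfl; exact hi hao
    -- On `F ∩ ker ψ` the value of `ψ` is a vanishing sum of nonnegative terms, so the coordinate
    -- `i` vanishes there, and these points span `ker ψ`.
    have hle : LinearMap.ker ψ ≤ LinearMap.ker (B.coord i) := by
      rw [← hspan, Submodule.span_le]
      rintro x ⟨hx, hxK⟩
      have hsum : ∑ k, B.repr x k * ψ (B k) = 0 := by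
        have h0 : ψ x = 0 := hxK
        rw [← B.sum_repr x, map_sum] at h0
        simpa only [map_smul, smul_eq_mul] using h0
      have hnn : ∀ k ∈ Finset.univ, 0 ≤ B.repr x k * ψ (B k) := by
        intro k _
        by_cases hk : k = o
        · rw [hk, hao, mul_zero]
        · exact mul_nonneg ((hF x).1 hx k hk) (ha k)
      have := (Finset.sum_eq_zero_iff_of_nonneg hnn).1 hsum i (Finset.mem_univ i)
      exact (mul_eq_zero.1 this).resolve_right hi
    refine ⟨i, hio, le_antisymm hle fun x hx => ?_⟩
    have h1 : x - (ψ x / ψ (B i)) • B i ∈ LinearMap.ker ψ := by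
      rw [LinearMap.mem_ker, map_sub, map_smul, smul_eq_mul, div_mul_cancel₀ _ hi, sub_self]
    have h2 := hle h1
    rw [LinearMap.mem_ker, map_sub, LinearMap.mem_ker.1 hx, map_smul, B.coord_apply,
      B.repr_self, Finsupp.single_eq_same, smul_eq_mul, mul_one, zero_sub, neg_eq_zero] at h2
    exact (div_eq_zero_iff.1 h2).resolve_right hi
  · rintro ⟨i, hi, rfl⟩
    refine ⟨⟨B.coord i, fun h => ?_, rfl, fun x hx => (hF x).1 hx i hi⟩, ?_⟩
    · have := congrArg (fun f => f (B i)) h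
      simp at this
    · refine le_antisymm (Submodule.span_le.2 fun x hx => hx.2) fun x hx => ?_
      rw [← B.sum_repr x]
      refine Submodule.sum_mem _ fun k _ => ?_
      by_cases hk : k = i
      · have : B.repr x i = 0 := hx
        rw [hk, this, zero_smul]
        exact Submodule.zero_mem _
      · refine Submodule.smul_mem _ _ (Submodule.subset_span
          ⟨basis_mem_of_mem_iff B hF k, ?_⟩)
        change B.repr (B k) i = 0
        rw [B.repr_self, Finsupp.single_eq_of_ne (Ne.symm hk)]

/-! ### The shape of the fundamental domain of an almost irreducible group -/

section AlmostIrreducible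

variable {W : Subgroup (V ≃ₗᵢ[ℝ] V)} {V₁ V₂ : Submodule ℝ V}

lemma IsAlmostIrreducible.mem_of_fixed (hV : IsAlmostIrreducible W V₁ V₂) {x : V}
    (hx : ∀ σ ∈ W, σ x = x) : x ∈ V₂ := by
  have hU : V₁ ⊓ ⨅ σ : W, LinearMap.ker
      (((σ : V ≃ₗᵢ[ℝ] V).toLinearEquiv : V →ₗ[ℝ] V) - LinearMap.id) = ⊥ := by
    have hfix : ∀ y, y ∈ V₁ ⊓ ⨅ σ : W, LinearMap.ker
        (((σ : V ≃ₗᵢ[ℝ] V).toLinearEquiv : V →ₗ[ℝ] V) - LinearMap.id) ↔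
        y ∈ V₁ ∧ ∀ σ ∈ W, σ y = y := by
      intro y
      simp [Submodule.mem_iInf, sub_eq_zero]
    refine (hV.irreducible _ inf_le_left fun σ hσ y hy => ?_).resolve_right fun h => ?_
    · rwa [((hfix y).1 hy).2 σ hσ]
    · obtain ⟨σ, hσ, y, hy, hne⟩ := hV.nontrivial
      rw [← h] at hy
      exact hne (((hfix y).1 hy).2 σ hσ)
  obtain ⟨y, hy, z, hz, rfl⟩ := Submodule.mem_sup.1
    (hV.isCompl.sup_eq_top ▸ Submodule.mem_top : x ∈ V₁ ⊔ V₂)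
  have hy0 : y ∈ (⊥ : Submodule ℝ V) := by
    rw [← hU]
    refine ⟨hy, ?_⟩
    simp only [SetLike.mem_coe, Submodule.mem_iInf, LinearMap.mem_ker, LinearMap.sub_apply,
      LinearMap.id_apply, sub_eq_zero]
    rintro ⟨σ, hσ⟩
    have := hx σ hσ
    rw [map_add, hV.trivial σ hσ z hz] at this
    exact add_right_cancel this
  rw [(Submodule.mem_bot ℝ).1 hy0, zero_add]
  exact hz

/-- Shape of a fundamental domain whose intersection with a monoconditional cone is simplicial. -/
lemma exists_fixed_generator [Finite W] (hV : IsAlmostIrreducible W V₁ V₂) {F : Set V}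
    (hF : IsFundamentalDomain W F) {φ : Module.Dual ℝ V} (hφ : ¬ V₂ ≤ LinearMap.ker φ)
    {κ : Type*} [Fintype κ] (B : Module.Basis κ ℝ V)
    (hB : ∀ x, x ∈ {x | ∀ σ ∈ W, 0 ≤ φ (σ x)} ∩ F ↔ ∀ i, 0 ≤ B.repr x i) :
    ∃ o, (∀ x, x ∈ F ↔ ∀ i, i ≠ o → 0 ≤ B.repr x i) ∧ ∀ σ ∈ W, σ (B o) = B o := by
  classical
  obtain ⟨v, hv, hφv⟩ : ∃ v ∈ V₂, 0 < φ v := by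
    obtain ⟨v, hv, hne⟩ := SetLike.not_le_iff_exists.1 hφ
    rcases lt_or_gt_of_ne (show φ v ≠ 0 from hne) with h | h
    · exact ⟨-v, V₂.neg_mem hv, by simpa using h⟩
    · exact ⟨v, hv, h⟩
  have hfix : ∀ σ ∈ W, σ v = v := fun σ hσ => hV.trivial σ hσ v hv
  have hfix' : ∀ t : ℝ, ∀ σ ∈ W, σ (t • v) = t • v := fun t σ hσ => by
    rw [map_smul, hfix σ hσ]
  have hvB : ∀ i, 0 ≤ B.repr v i := by
    rw [← hB]
    exact ⟨fun σ hσ => by rw [hfix σ hσ]; exact hφv.le, hF.mem_of_fixed hfix⟩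
  -- A large multiple of `v` brings any point of `F` into `C` without leaving `F`, and makes every
  -- coordinate positive in which `v` is positive. As `-v` is fixed too, the shift can be undone
  -- inside `F`.
  have hmem : ∀ x, x ∈ F ↔ ∀ i, B.repr v i = 0 → 0 ≤ B.repr x i := by
    intro x
    constructor
    · intro hx i hi
      have hev : ∀ᶠ t : ℝ in atTop, ∀ σ : W, 0 ≤ φ ((σ : V ≃ₗᵢ[ℝ] V) x) + t * φ v := by
        refine eventually_all.2 fun σ => ?_
        exact (tendsto_atTop_add_const_left _ _
          (tendsto_id.atTop_mul_const hφv)).eventually_ge_atTop 0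
      obtain ⟨t, ht⟩ := hev.exists
      have h1 : x + t • v ∈ {x | ∀ σ ∈ W, 0 ≤ φ (σ x)} ∩ F := by
        refine ⟨fun σ hσ => ?_, hF.add_mem_of_fixed hx (hfix' t)⟩
        rw [map_add, hfix' t σ hσ, map_add, map_smul, smul_eq_mul]
        exact ht ⟨σ, hσ⟩
      simpa [hi] using (hB _).1 h1 i
    · intro h
      have hev : ∀ᶠ t : ℝ in atTop, ∀ i, 0 ≤ B.repr x i + t * B.repr v i := by
        refine eventually_all.2 fun i => ?_
        rcases (hvB i).eq_or_lt with h0 | h0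
        · exact Eventually.of_forall fun t => by simpa [← h0] using h i h0.symm
        · exact (tendsto_atTop_add_const_left _ _
            (tendsto_id.atTop_mul_const h0)).eventually_ge_atTop 0
      obtain ⟨t, ht⟩ := hev.exists
      have h1 : x + t • v ∈ F := ((hB _).2 (by simpa using ht)).2
      have h2 := hF.add_mem_of_fixed h1 (hfix' (-t))
      simpa using h2
  -- Such a `B i` lies in `F` together with its negative. It is therefore fixed by `W` and belongs
  -- to the line `V₂`, so there is only one such index.
  have hspan : ∀ i, B.repr v i ≠ 0 → (∀ σ ∈ W, σ (B i) = B i) ∧ ∃ c : ℝ, B i = c • v := by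
    intro i hi
    have h0 : ∀ k, B.repr v k = 0 → B.repr (B i) k = 0 := by
      intro k hk
      rw [B.repr_self, Finsupp.single_eq_of_ne]
      rintro rfl
      exact hi hk
    have h1 : ∀ σ ∈ W, σ (B i) = B i := fun σ hσ =>
      hF.fixed_of_mem_of_neg_mem ((hmem _).2 fun k hk => (h0 k hk).ge)
        ((hmem _).2 fun k hk => by
          rw [map_neg, Finsupp.neg_apply, h0 k hk, neg_zero]) hσ
    refine ⟨h1, ?_⟩
    have hv0 : (⟨v, hv⟩ : V₂) ≠ 0 := by
      intro h
      have : v = 0 := congrArg Subtype.val h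
      simp [this] at hφv
    obtain ⟨c, hc⟩ := (finrank_eq_one_iff_of_nonzero' _ hv0).1 hV.finrank_eq_one
      ⟨B i, hV.mem_of_fixed h1⟩
    exact ⟨c, (congrArg Subtype.val hc).symm⟩
  obtain ⟨o, ho⟩ : ∃ o, B.repr v o ≠ 0 := by
    by_contra! h
    have : v = 0 := by
      apply B.repr.injective
      ext i
      simp [h i]
    simp [this] at hφv
  refine ⟨o, fun x => (hmem x).trans (forall_congr' fun i => ?_), (hspan o ho).1⟩
  suffices h : B.repr v i = 0 ↔ i ≠ o by rw [h]
  refine ⟨fun h h' => ho (h' ▸ h), fun h => ?_⟩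
  obtain ⟨c, hc⟩ := (hspan o ho).2
  have h1 : B.repr (B o) i = c * B.repr v i := by rw [hc]; simp
  have h2 : B.repr (B o) o = c * B.repr v o := by
    conv_lhs => rw [hc]
    simp
  rw [B.repr_self, Finsupp.single_eq_same] at h2
  rw [B.repr_self, Finsupp.single_eq_of_ne h] at h1
  refine (mul_eq_zero.1 h1.symm).resolve_left ?_
  rintro rfl
  simp at h2

end AlmostIrreducible

/-! ### Existence and uniqueness of the enumeration of the primitive generators -/

section Lattice

variable {C F : Set V} {r : ℕ} {H : Fin r → Submodule ℝ V}

/-- A basis whose members avoid the facet hyperplanes in order is dual to the facets. -/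
lemma eq_last_and_eq_ker_coord (B : Module.Basis (Fin (r + 1)) ℝ V) {o : Fin (r + 1)}
    (hFB : ∀ x, x ∈ F ↔ ∀ i, i ≠ o → 0 ≤ B.repr x i)
    (hHF : Set.range H = {K | IsFacetHyperplane F K}) (hB : ∀ j, B j.castSucc ∉ H j) :
    o = Fin.last r ∧ ∀ j, H j = LinearMap.ker (B.coord j.castSucc) := by
  have h1 : ∀ j : Fin r, j.castSucc ≠ o ∧ H j = LinearMap.ker (B.coord j.castSucc) := by
    intro j
    have : H j ∈ {K | IsFacetHyperplane F K} := hHF ▸ Set.mem_range_self j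
    obtain ⟨i, hi, hj⟩ := (isFacetHyperplane_iff B hFB _).1 this
    have h2 := hB j
    rw [hj] at h2
    have : j.castSucc = i := by
      by_contra h
      exact h2 (by rw [LinearMap.mem_ker, B.coord_apply, B.repr_self,
        Finsupp.single_eq_of_ne (Ne.symm h)])
    subst this
    exact ⟨hi, hj⟩
  refine ⟨?_, fun j => (h1 j).2⟩
  by_contra h
  obtain ⟨j, hj⟩ := Fin.exists_castSucc_eq.2 h
  exact (h1 j).1 hj

variable [FiniteDimensional ℝ V] {Γ : Submodule ℤ V} [DiscreteTopology Γ] [IsZLattice ℝ Γ]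

lemma isGeneratedBy_iff {κ : Type*} [Fintype κ] (b : Module.Basis κ ℤ Γ) (K : Set V) :
    IsGeneratedBy K b ↔ ∀ x, x ∈ K ↔ ∀ i, 0 ≤ (b.ofZLatticeBasis ℝ Γ).repr x i := by
  rw [IsGeneratedBy, Set.ext_iff]
  refine forall_congr' fun x => ?_
  suffices h : (x ∈ {x | ∃ c : κ → ℝ, (∀ i, 0 ≤ c i) ∧ x = ∑ i, c i • (b i : V)}) ↔
      ∀ i, 0 ≤ (b.ofZLatticeBasis ℝ Γ).repr x i by rw [h]
  constructor
  · rintro ⟨c, hc, rfl⟩ i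
    have : ∑ i, c i • (b i : V) = ∑ i, c i • b.ofZLatticeBasis ℝ Γ i := by simp
    rw [this, Module.Basis.repr_sum_self]
    exact hc i
  · intro h
    exact ⟨_, h, by simpa using ((b.ofZLatticeBasis ℝ Γ).sum_repr x).symm⟩

lemma exists_enumeration {κ : Type*} [Fintype κ] (b : Module.Basis κ ℤ Γ) {o : κ}
    (hFb : ∀ x, x ∈ F ↔ ∀ i, i ≠ o → 0 ≤ (b.ofZLatticeBasis ℝ Γ).repr x i)
    (hK : IsGeneratedBy (C ∩ F) b) (hH : Function.Injective H)
    (hHF : Set.range H = {K | IsFacetHyperplane F K}) :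
    ∃ b' : Module.Basis (Fin (r + 1)) ℤ Γ, IsGeneratedBy (C ∩ F) b' ∧
      ∀ j : Fin r, (b' j.castSucc : V) ∉ H j := by
  classical
  set B := b.ofZLatticeBasis ℝ Γ with hB
  have h1 : ∀ j : Fin r, ∃ i, i ≠ o ∧ H j = LinearMap.ker (B.coord i) := fun j =>
    (isFacetHyperplane_iff B hFb _).1
      (show H j ∈ {K | IsFacetHyperplane F K} from hHF ▸ Set.mem_range_self j)
  choose g hgo hg using h1
  -- The generator `o`, which lies on all facet hyperplanes, comes last; `g j` is the only generator
  -- off `H j`.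
  have hbij : Function.Bijective (Fin.lastCases o g : Fin (r + 1) → κ) := by
    constructor
    · intro i k h
      induction i using Fin.lastCases with
      | last =>
        induction k using Fin.lastCases with
        | last => rfl
        | cast k => simp only [Fin.lastCases_last, Fin.lastCases_castSucc] at h; exact absurd h.symm (hgo k)
      | cast i =>
        induction k using Fin.lastCases with
        | last => simp only [Fin.lastCases_last, Fin.lastCases_castSucc] at h; exact absurd h (hgo i)
        | cast k =>
          simp only [Fin.lastCases_castSucc] at h
          rw [hH (show H i = H k by rw [hg i, hg k, h])]
    · intro i
      by_cases hi : i = o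
      · exact ⟨Fin.last r, by simp [hi]⟩
      · have : LinearMap.ker (B.coord i) ∈ Set.range H := by
          rw [hHF]
          exact (isFacetHyperplane_iff B hFb _).2 ⟨i, hi, rfl⟩
        obtain ⟨j, hj⟩ := this
        refine ⟨j.castSucc, ?_⟩
        simp only [Fin.lastCases_castSucc]
        exact ker_coord_injective B ((hg j).symm.trans hj)
  let E := (Equiv.ofBijective _ hbij).symm
  refine ⟨b.reindex E, ?_, fun j => ?_⟩
  · rw [IsGeneratedBy] at hK ⊢
    rw [hK]
    ext x
    constructor
    · rintro ⟨c, hc, rfl⟩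
      refine ⟨fun i => c (E.symm i), fun i => hc _, ?_⟩
      simp only [Module.Basis.reindex_apply]
      exact (E.symm.sum_comp (fun i => c i • (b i : V))).symm
    · rintro ⟨c, hc, rfl⟩
      refine ⟨fun i => c (E i), fun i => hc _, ?_⟩
      simp only [Module.Basis.reindex_apply]
      rw [← E.sum_comp (fun i => c i • (b (E.symm i) : V))]
      simp
  · have : E.symm j.castSucc = g j := by
      simp [E]
    rw [Module.Basis.reindex_apply, this, hg j, LinearMap.mem_ker,
      ← b.ofZLatticeBasis_apply ℝ Γ, B.coord_apply, B.repr_self]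
    simp

/-- Forms with equal kernels are proportional. Both take integer values on `Γ`, and the first takes
the value 1 there, so the nonnegative factor is an integer dividing 1. -/
lemma coord_eq_of_ker_eq {κ : Type*} [Finite κ] (b b' : Module.Basis κ ℤ Γ) {i : κ}
    (h : LinearMap.ker ((b.ofZLatticeBasis ℝ Γ).coord i) =
      LinearMap.ker ((b'.ofZLatticeBasis ℝ Γ).coord i))
    (hpos : 0 ≤ (b.ofZLatticeBasis ℝ Γ).repr (b' i : V) i) (x : V) :
    (b.ofZLatticeBasis ℝ Γ).repr x i = (b'.ofZLatticeBasis ℝ Γ).repr x i := by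
  set B := b.ofZLatticeBasis ℝ Γ with hB
  set B' := b'.ofZLatticeBasis ℝ Γ with hB'
  have key : ∀ x, B.repr x i = B'.repr x i * B.repr (b' i : V) i := by
    intro x
    have h1 : x - B'.repr x i • (b' i : V) ∈ LinearMap.ker (B.coord i) := by
      rw [h, ← b'.ofZLatticeBasis_apply ℝ Γ, LinearMap.mem_ker, map_sub, map_smul,
        B'.coord_apply, B'.coord_apply, B'.repr_self]
      simp
    rw [LinearMap.mem_ker, map_sub, map_smul, sub_eq_zero] at h1
    exact h1
  have h1 : B.repr (b i : V) i = 1 := by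
    rw [← b.ofZLatticeBasis_apply ℝ Γ, B.repr_self]; simp
  have h2 := key (b i : V)
  rw [h1, hB, hB', b.ofZLatticeBasis_repr_apply ℝ Γ, b'.ofZLatticeBasis_repr_apply ℝ Γ] at h2
  rw [hB, b.ofZLatticeBasis_repr_apply ℝ Γ] at hpos
  have h3 : b.repr (b' i) i = 1 := by
    refine Int.eq_one_of_mul_eq_one_left (by exact_mod_cast hpos) (a := b'.repr (b i) i) ?_
    exact_mod_cast h2.symm
  rw [key, hB, b.ofZLatticeBasis_repr_apply ℝ Γ, h3]
  simp

/-- All coordinates but the last agree, so both last generators span the line where these vanish;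
primitivity and positivity make them equal. Two other generators with the same index differ by a
multiple of the last one. The coefficient is nonnegative as a coordinate of `B' j` and nonpositive
as minus a coordinate of `B j`, hence zero. -/
lemma enumeration_unique (b b' : Module.Basis (Fin (r + 1)) ℤ Γ) {K : Set V}
    (hK : IsGeneratedBy K b) (hK' : IsGeneratedBy K b')
    (hker : ∀ j, H j = LinearMap.ker ((b.ofZLatticeBasis ℝ Γ).coord j.castSucc))
    (hker' : ∀ j, H j = LinearMap.ker ((b'.ofZLatticeBasis ℝ Γ).coord j.castSucc)) :
    b = b' := by
  rw [isGeneratedBy_iff] at hK hK'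
  set B := b.ofZLatticeBasis ℝ Γ with hB
  set B' := b'.ofZLatticeBasis ℝ Γ with hB'
  have hb : ∀ i, (b i : V) = B i := fun i => by simp [hB]
  have hb' : ∀ i, (b' i : V) = B' i := fun i => by simp [hB']
  have hmem : ∀ i, B i ∈ K := fun i => (hK _).2 fun k => by
    rw [B.repr_self, Finsupp.single_apply]; split_ifs <;> norm_num
  have hmem' : ∀ i, B' i ∈ K := fun i => (hK' _).2 fun k => by
    rw [B'.repr_self, Finsupp.single_apply]; split_ifs <;> norm_num
  have hc : ∀ (j : Fin r) (x : V), B.repr x j.castSucc = B'.repr x j.castSucc := fun j x =>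
    coord_eq_of_ker_eq b b' ((hker j).symm.trans (hker' j)) (by
      rw [hb']; exact (hK _).1 (hmem' _) _) x
  have hdiff : ∀ x, (∀ j : Fin r, B.repr x j.castSucc = 0) →
      x = B.repr x (Fin.last r) • B (Fin.last r) := by
    intro x hx
    conv_lhs => rw [← B.sum_repr x, Fin.sum_univ_castSucc]
    simp [hx]
  have hdiff' : ∀ x, (∀ j : Fin r, B.repr x j.castSucc = 0) →
      x = B'.repr x (Fin.last r) • B' (Fin.last r) := by
    intro x hx
    conv_lhs => rw [← B'.sum_repr x, Fin.sum_univ_castSucc]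
    simp [← hc, hx]
  have hz : ∀ j : Fin r, B.repr (B (Fin.last r)) j.castSucc = 0 := fun j => by
    rw [B.repr_self, Finsupp.single_eq_of_ne (Fin.castSucc_lt_last j).ne]
  have hz' : ∀ j : Fin r, B.repr (B' (Fin.last r)) j.castSucc = 0 := fun j => by
    rw [hc, B'.repr_self, Finsupp.single_eq_of_ne (Fin.castSucc_lt_last j).ne]
  have hlast : B' (Fin.last r) = B (Fin.last r) := by
    have e1 := hdiff _ hz'
    have e2 : B.repr (B' (Fin.last r)) (Fin.last r) *
        B'.repr (B (Fin.last r)) (Fin.last r) = 1 := by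
      have := congrArg (fun x => B'.repr x (Fin.last r)) e1
      simpa using this.symm
    have h0 := (hK _).1 (hmem' (Fin.last r)) (Fin.last r)
    rw [← hb', hB, b.ofZLatticeBasis_repr_apply ℝ Γ] at h0
    rw [← hb, ← hb', hB, hB', b.ofZLatticeBasis_repr_apply ℝ Γ,
      b'.ofZLatticeBasis_repr_apply ℝ Γ] at e2
    have h3 : b.repr (b' (Fin.last r)) (Fin.last r) = 1 :=
      Int.eq_one_of_mul_eq_one_right (by exact_mod_cast h0) (by exact_mod_cast e2)
    rw [e1, ← hb', hB, b.ofZLatticeBasis_repr_apply ℝ Γ, h3]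
    simp
  have hall : ∀ i, B' i = B i := by
    intro i
    induction i using Fin.lastCases with
    | last => exact hlast
    | cast j =>
      have h0 : ∀ k : Fin r, B.repr (B' j.castSucc - B j.castSucc) k.castSucc = 0 := by
        intro k
        rw [map_sub, Finsupp.sub_apply, hc k (B' _), B.repr_self, B'.repr_self, sub_self]
      have hne : Fin.last r ≠ j.castSucc := (Fin.castSucc_lt_last j).ne'
      have e1 := hdiff _ h0
      have e2 := hdiff' _ h0
      rw [map_sub, Finsupp.sub_apply, B.repr_self, Finsupp.single_eq_of_ne hne, sub_zero] at e1
      rw [map_sub, Finsupp.sub_apply, B'.repr_self, Finsupp.single_eq_of_ne hne, zero_sub,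
        hlast] at e2
      have h1 := (hK _).1 (hmem' j.castSucc) (Fin.last r)
      have h2 := (hK' _).1 (hmem j.castSucc) (Fin.last r)
      have h3 := smul_left_injective ℝ (B.ne_zero (Fin.last r)) (e1.symm.trans e2)
      have h4 : B.repr (B' j.castSucc) (Fin.last r) = 0 := by
        linarith
      rw [h4, zero_smul] at e1
      exact sub_eq_zero.1 e1
  refine Module.Basis.eq_of_apply_eq fun i => Subtype.ext ?_
  rw [hb, hb', hall]

end Lattice

end SymCone

/-! ### Simple systems, inversions, length and descents -/

namespace SymCone

variable {V : Type*} [NormedAddCommGroup V] [InnerProductSpace ℝ V]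

/-- The orthogonal reflection at the hyperplane orthogonal to `β`. -/
noncomputable def reflectionAt (β : V) : V ≃ₗᵢ[ℝ] V := (Submodule.span ℝ {β})ᗮ.reflection

lemma reflectionAt_apply {β : V} (hβ : ‖β‖ = 1) (x : V) :
    reflectionAt β x = x - (2 * ⟪β, x⟫_ℝ) • β := by
  rw [reflectionAt, Submodule.reflection_orthogonal_apply, Submodule.reflection_singleton_apply, hβ]
  simp only [RCLike.ofReal_real_eq_id, id, one_pow, div_one]
  rw [neg_sub, mul_smul, two_smul, two_smul]

lemma reflectionAt_self {β : V} (hβ : ‖β‖ = 1) : reflectionAt β β = -β := by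
  rw [reflectionAt_apply hβ, real_inner_self_eq_norm_sq, hβ]
  module

lemma reflectionAt_neg {β : V} (hβ : ‖β‖ = 1) : reflectionAt (-β) = reflectionAt β := by
  ext x
  rw [reflectionAt_apply (by rwa [norm_neg]), reflectionAt_apply hβ, inner_neg_left]
  module

lemma reflectionAt_reflectionAt (β x : V) : reflectionAt β (reflectionAt β x) = x :=
  Submodule.reflection_reflection _ _

lemma reflectionAt_mul_self (β : V) : reflectionAt β * reflectionAt β = 1 := by
  ext x
  exact reflectionAt_reflectionAt β x

lemma reflectionAt_inv (β : V) : (reflectionAt β)⁻¹ = reflectionAt β :=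
  inv_eq_of_mul_eq_one_left (reflectionAt_mul_self β)

lemma inner_inv_apply (σ : V ≃ₗᵢ[ℝ] V) (x y : V) : ⟪x, σ⁻¹ y⟫_ℝ = ⟪σ x, y⟫_ℝ := by
  rw [← σ.inner_map_map x]
  exact congrArg (⟪σ x, ·⟫_ℝ) (σ.apply_symm_apply y)

lemma inner_reflectionAt (β x y : V) : ⟪reflectionAt β x, y⟫_ℝ = ⟪x, reflectionAt β y⟫_ℝ := by
  rw [← inner_inv_apply, reflectionAt_inv]

lemma reflectionAt_map {β : V} (hβ : ‖β‖ = 1) (σ : V ≃ₗᵢ[ℝ] V) :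
    reflectionAt (σ β) = σ * reflectionAt β * σ⁻¹ := by
  ext x
  change reflectionAt (σ β) x = σ (reflectionAt β (σ⁻¹ x))
  rw [reflectionAt_apply (by rwa [σ.norm_map]), reflectionAt_apply hβ, inner_inv_apply, map_sub,
    map_smul]
  congr 1
  exact (σ.apply_symm_apply x).symm

/-- Unit normals `α j` of the walls of a fundamental domain `F`: they cut out `F`, the reflections
at the walls belong to the group, and each wall has a relatively interior point. -/
structure IsSimpleSystem (W : Subgroup (V ≃ₗᵢ[ℝ] V)) (F : Set V) {r : ℕ} (α : Fin r → V) :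
    Prop where
  norm_eq : ∀ j, ‖α j‖ = 1
  reflection_mem : ∀ j, reflectionAt (α j) ∈ W
  mem_iff : ∀ x, x ∈ F ↔ ∀ j, 0 ≤ ⟪α j, x⟫_ℝ
  exists_wall_point : ∀ j, ∃ q ∈ F, ⟪α j, q⟫_ℝ = 0 ∧
    ∀ β, (∀ x ∈ F, 0 ≤ ⟪β, x⟫_ℝ) → ⟪β, q⟫_ℝ = 0 → ∃ c : ℝ, 0 ≤ c ∧ β = c • α j

variable {W : Subgroup (V ≃ₗᵢ[ℝ] V)} [Finite W] {F : Set V}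

namespace IsFundamentalDomain

lemma inner_ne_zero (hF : IsFundamentalDomain W F) {p : V} (hp : p ∈ interior F) {β : V}
    (hβ : ‖β‖ = 1) (hβW : reflectionAt β ∈ W) : ⟪β, p⟫_ℝ ≠ 0 := by
  intro h
  have h1 : reflectionAt β = 1 := hF.eq_one_of_apply_eq hp hβW (by
    rw [reflectionAt_apply hβ, h]; simp)
  have h2 := reflectionAt_self hβ
  rw [h1] at h2
  have h3 : (2 : ℝ) • β = 0 := by
    rw [two_smul]
    exact add_eq_zero_iff_eq_neg.2 h2
  have h4 : β = 0 := (smul_eq_zero.1 h3).resolve_left two_ne_zero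
  simp [h4] at hβ

lemma inner_nonneg_of_pos (hF : IsFundamentalDomain W F) {p : V} (hp : p ∈ interior F) {β : V}
    (hβ : ‖β‖ = 1) (hβW : reflectionAt β ∈ W) (h : 0 < ⟪β, p⟫_ℝ) {x : V} (hx : x ∈ F) :
    0 ≤ ⟪β, x⟫_ℝ := by
  have h1 := hF.inner_apply_le hβW hx (interior_subset hp)
  rw [reflectionAt_apply hβ, inner_sub_right, inner_smul_right, real_inner_comm β x] at h1
  by_contra! h2
  nlinarith [mul_neg_of_pos_of_neg h h2]

end IsFundamentalDomain

namespace IsSimpleSystem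

variable {r : ℕ} {α : Fin r → V} {p : V}

lemma inner_pos (hα : IsSimpleSystem W F α) (hF : IsFundamentalDomain W F)
    (hp : p ∈ interior F) (j : Fin r) : 0 < ⟪α j, p⟫_ℝ :=
  lt_of_le_of_ne ((hα.mem_iff p).1 (interior_subset hp) j)
    (hF.inner_ne_zero hp (hα.norm_eq j) (hα.reflection_mem j)).symm

/-- The simple reflection permutes the other positive roots: at a relatively interior point `q` of
the wall only multiples of `α j` vanish, so `β` is positive at `q`, and so is its reflection because
`q` is fixed. -/
lemma inner_reflectionAt_pos (hα : IsSimpleSystem W F α) (hF : IsFundamentalDomain W F)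
    (hp : p ∈ interior F) (j : Fin r) {β : V} (hβ : ‖β‖ = 1) (hβW : reflectionAt β ∈ W)
    (h : 0 < ⟪β, p⟫_ℝ) (hne : β ≠ α j) : 0 < ⟪reflectionAt (α j) β, p⟫_ℝ := by
  obtain ⟨q, hq, hjq, hwall⟩ := hα.exists_wall_point j
  have hβF : ∀ x ∈ F, 0 ≤ ⟪β, x⟫_ℝ := fun x hx => hF.inner_nonneg_of_pos hp hβ hβW h hx
  have hpos : 0 < ⟪β, q⟫_ℝ := by
    refine lt_of_le_of_ne (hβF q hq) fun h0 => hne ?_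
    obtain ⟨c, hc, rfl⟩ := hwall β hβF h0.symm
    rw [norm_smul, hα.norm_eq, mul_one, Real.norm_of_nonneg hc] at hβ
    rw [hβ, one_smul]
  have hγ : ‖reflectionAt (α j) β‖ = 1 := by rw [LinearIsometryEquiv.norm_map, hβ]
  have hγW : reflectionAt (reflectionAt (α j) β) ∈ W := by
    rw [reflectionAt_map hβ]
    exact W.mul_mem (W.mul_mem (hα.reflection_mem j) hβW) (W.inv_mem (hα.reflection_mem j))
  have hγq : ⟪reflectionAt (α j) β, q⟫_ℝ = ⟪β, q⟫_ℝ := by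
    rw [inner_reflectionAt, reflectionAt_apply (hα.norm_eq j), hjq]
    simp
  by_contra! h0
  have h1 : 0 < ⟪-reflectionAt (α j) β, p⟫_ℝ := by
    rw [inner_neg_left]
    have := lt_of_le_of_ne h0 (hF.inner_ne_zero hp hγ hγW)
    linarith
  have h2 : reflectionAt (-reflectionAt (α j) β) ∈ W := by
    rwa [reflectionAt_neg hγ]
  have h3 := hF.inner_nonneg_of_pos hp (by rwa [norm_neg]) h2 h1 hq
  rw [inner_neg_left, hγq] at h3
  linarith

/-- The roots: the images of the simple roots under the group. -/
noncomputable def roots (W : Subgroup (V ≃ₗᵢ[ℝ] V)) [Finite W] (α : Fin r → V) : Finset V :=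
  (Set.finite_range fun a : W × Fin r => (a.1 : V ≃ₗᵢ[ℝ] V) (α a.2)).toFinset

lemma mem_roots {β : V} :
    β ∈ roots W α ↔ ∃ σ ∈ W, ∃ j, σ (α j) = β := by
  simp [roots]

lemma map_mem_roots {β : V} {σ : V ≃ₗᵢ[ℝ] V} (hσ : σ ∈ W) (h : β ∈ roots W α) :
    σ β ∈ roots W α := by
  obtain ⟨τ, hτ, j, rfl⟩ := mem_roots.1 h
  exact mem_roots.2 ⟨σ * τ, W.mul_mem hσ hτ, j, rfl⟩

lemma simple_mem_roots (j : Fin r) : α j ∈ roots W α :=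
  mem_roots.2 ⟨1, W.one_mem, j, rfl⟩

lemma norm_root (hα : IsSimpleSystem W F α) {β : V} (h : β ∈ roots W α) : ‖β‖ = 1 := by
  obtain ⟨τ, hτ, j, rfl⟩ := mem_roots.1 h
  rw [τ.norm_map, hα.norm_eq]

lemma reflectionAt_root_mem (hα : IsSimpleSystem W F α) {β : V} (h : β ∈ roots W α) :
    reflectionAt β ∈ W := by
  obtain ⟨τ, hτ, j, rfl⟩ := mem_roots.1 h
  rw [reflectionAt_map (hα.norm_eq j)]
  exact W.mul_mem (W.mul_mem hτ (hα.reflection_mem j)) (W.inv_mem hτ)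

/-- The positive roots that `σ` maps to negative roots. -/
noncomputable def inversions (W : Subgroup (V ≃ₗᵢ[ℝ] V)) [Finite W] (α : Fin r → V) (p : V)
    (σ : V ≃ₗᵢ[ℝ] V) : Finset V := by
  classical exact (roots W α).filter fun β => 0 < ⟪β, p⟫_ℝ ∧ ⟪σ β, p⟫_ℝ < 0

lemma mem_inversions {σ : V ≃ₗᵢ[ℝ] V} {β : V} :
    β ∈ inversions W α p σ ↔ β ∈ roots W α ∧ 0 < ⟪β, p⟫_ℝ ∧ ⟪σ β, p⟫_ℝ < 0 := by
  simp [inversions]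

/-- The inversions of `σ s_j` are `α j` and the images under `s_j` of those of `σ`. -/
lemma card_inversions_mul (hα : IsSimpleSystem W F α) (hF : IsFundamentalDomain W F)
    (hp : p ∈ interior F) (j : Fin r) {σ : V ≃ₗᵢ[ℝ] V} (h : 0 < ⟪σ (α j), p⟫_ℝ) :
    (inversions W α p (σ * reflectionAt (α j))).card = (inversions W α p σ).card + 1 := by
  classical
  have hj : α j ∉ inversions W α p σ := fun h' => lt_asymm h (mem_inversions.1 h').2.2
  have himg : inversions W α p (σ * reflectionAt (α j)) =
      insert (α j) ((inversions W α p σ).image (reflectionAt (α j))) := by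
    ext β
    rw [Finset.mem_insert, Finset.mem_image, mem_inversions]
    constructor
    · rintro ⟨h1, h2, h3⟩
      by_cases hβ : β = α j
      · exact Or.inl hβ
      · refine Or.inr ⟨reflectionAt (α j) β, mem_inversions.2
          ⟨map_mem_roots (hα.reflection_mem j) h1, ?_, h3⟩, reflectionAt_reflectionAt _ _⟩
        exact hα.inner_reflectionAt_pos hF hp j (hα.norm_root h1) (hα.reflectionAt_root_mem h1)
          h2 hβ
    · rintro (rfl | ⟨γ, hγ, rfl⟩)
      · refine ⟨simple_mem_roots j, hα.inner_pos hF hp j, ?_⟩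
        change ⟪σ (reflectionAt (α j) (α j)), p⟫_ℝ < 0
        rw [reflectionAt_self (hα.norm_eq j), map_neg, inner_neg_left]
        linarith
      · obtain ⟨h1, h2, h3⟩ := mem_inversions.1 hγ
        refine ⟨map_mem_roots (hα.reflection_mem j) h1, ?_, ?_⟩
        · refine hα.inner_reflectionAt_pos hF hp j (hα.norm_root h1)
            (hα.reflectionAt_root_mem h1) h2 ?_
          rintro rfl
          exact hj hγ
        · change ⟪σ (reflectionAt (α j) (reflectionAt (α j) γ)), p⟫_ℝ < 0
          rwa [reflectionAt_reflectionAt]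
  rw [himg, Finset.card_insert_of_notMem, Finset.card_image_of_injective _
    (reflectionAt (α j)).injective]
  intro h'
  obtain ⟨γ, hγ, hγj⟩ := Finset.mem_image.1 h'
  have h1 : γ = -α j := by
    rw [← reflectionAt_reflectionAt (α j) γ, hγj, reflectionAt_self (hα.norm_eq j)]
  have h2 := (mem_inversions.1 hγ).2.1
  rw [h1, inner_neg_left] at h2
  linarith [hα.inner_pos hF hp j]

lemma card_inversions_of_neg (hα : IsSimpleSystem W F α) (hF : IsFundamentalDomain W F)
    (hp : p ∈ interior F) (j : Fin r) {σ : V ≃ₗᵢ[ℝ] V} (h : ⟪σ (α j), p⟫_ℝ < 0) :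
    (inversions W α p σ).card = (inversions W α p (σ * reflectionAt (α j))).card + 1 := by
  have h1 := hα.card_inversions_mul hF hp j (σ := σ * reflectionAt (α j)) (by
    change 0 < ⟪σ (reflectionAt (α j) (α j)), p⟫_ℝ
    rw [reflectionAt_self (hα.norm_eq j), map_neg, inner_neg_left]
    linarith)
  rwa [mul_assoc, reflectionAt_mul_self, mul_one] at h1

lemma inner_map_ne_zero (hα : IsSimpleSystem W F α) (hF : IsFundamentalDomain W F)
    (hp : p ∈ interior F) (j : Fin r) {σ : V ≃ₗᵢ[ℝ] V} (hσ : σ ∈ W) :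
    ⟪σ (α j), p⟫_ℝ ≠ 0 := by
  have h := map_mem_roots hσ (simple_mem_roots (W := W) (α := α) j)
  exact hF.inner_ne_zero hp (hα.norm_root h) (hα.reflectionAt_root_mem h)

lemma card_inversions_le (hα : IsSimpleSystem W F α) (hF : IsFundamentalDomain W F)
    (hp : p ∈ interior F) (w : List (Fin r)) :
    (w.map fun j => reflectionAt (α j)).prod ∈ W ∧
      (inversions W α p (w.map fun j => reflectionAt (α j)).prod).card ≤ w.length := by
  induction w using List.reverseRecOn with
  | nil =>
    refine ⟨W.one_mem, ?_⟩
    rw [List.length_nil, Nat.le_zero, Finset.card_eq_zero, Finset.eq_empty_iff_forall_notMem]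
    intro β hβ
    obtain ⟨-, h1, h2⟩ := mem_inversions.1 hβ
    exact lt_asymm h1 h2
  | append_singleton w j ih =>
    rw [List.map_append, List.prod_append, List.map_singleton, List.prod_singleton,
      List.length_append, List.length_singleton]
    refine ⟨W.mul_mem ih.1 (hα.reflection_mem j), ?_⟩
    rcases lt_or_gt_of_ne (hα.inner_map_ne_zero hF hp j ih.1) with h | h
    · have := hα.card_inversions_of_neg hF hp j h
      omega
    · rw [hα.card_inversions_mul hF hp j h]
      omega

/-- Multiplying by a simple reflection at a descent removes one inversion. Without descents `σ⁻¹ p`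
lies in `F`, which forces `σ = 1`. -/
lemma exists_word (hα : IsSimpleSystem W F α) (hF : IsFundamentalDomain W F)
    (hp : p ∈ interior F) {σ : V ≃ₗᵢ[ℝ] V} (hσ : σ ∈ W) :
    ∃ w : List (Fin r), w.length = (inversions W α p σ).card ∧
      (w.map fun j => reflectionAt (α j)).prod = σ := by
  induction hn : (inversions W α p σ).card using Nat.strong_induction_on generalizing σ with
  | _ n ih =>
    by_cases h : ∃ j, ⟪σ (α j), p⟫_ℝ < 0
    · obtain ⟨j, hj⟩ := h
      have h1 := hα.card_inversions_of_neg hF hp j hj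
      obtain ⟨w, hw, hwσ⟩ := ih _ (by omega) (W.mul_mem hσ (hα.reflection_mem j)) rfl
      refine ⟨w ++ [j], ?_, ?_⟩
      · rw [List.length_append, List.length_singleton]
        omega
      · rw [List.map_append, List.prod_append, hwσ, List.map_singleton, List.prod_singleton,
          mul_assoc, reflectionAt_mul_self, mul_one]
    · push Not at h
      have h1 : σ⁻¹ p ∈ F := by
        rw [hα.mem_iff]
        intro j
        rw [inner_inv_apply]
        exact h j
      have h2 := hF.eq_one_of_apply_eq hp (W.inv_mem hσ)
        (hF.apply_eq_self (W.inv_mem hσ) (interior_subset hp) h1)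
      have h3 : σ = 1 := inv_eq_one.1 h2
      subst h3
      refine ⟨[], ?_, rfl⟩
      have h0 := (hα.card_inversions_le hF hp []).2
      simp only [List.map_nil, List.prod_nil, List.length_nil, Nat.le_zero] at h0
      rw [← hn, h0, List.length_nil]

lemma length_eq (hα : IsSimpleSystem W F α) (hF : IsFundamentalDomain W F)
    (hp : p ∈ interior F) {σ : V ≃ₗᵢ[ℝ] V} (hσ : σ ∈ W) :
    length (fun j => reflectionAt (α j)) σ = (inversions W α p σ).card := by
  have hex := hα.exists_word hF hp hσ
  refine le_antisymm (Nat.sInf_le hex) ?_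
  -- By `hex` the set is nonempty, so `length` is not the default value 0 of `sInf ∅`.
  obtain ⟨w, hw, hwσ⟩ := Nat.sInf_mem (s := {k | ∃ w : List (Fin r), w.length = k ∧
    (w.map fun j => reflectionAt (α j)).prod = σ}) ⟨_, hex⟩
  rw [length, ← hw, ← hwσ]
  exact (hα.card_inversions_le hF hp w).2

lemma mem_rightDescents_iff (hα : IsSimpleSystem W F α) (hF : IsFundamentalDomain W F)
    (hp : p ∈ interior F) {σ : V ≃ₗᵢ[ℝ] V} (hσ : σ ∈ W) (j : Fin r) :
    j ∈ rightDescents (fun j => reflectionAt (α j)) σ ↔ ⟪σ (α j), p⟫_ℝ < 0 := by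
  rw [rightDescents, Finset.mem_filter, hα.length_eq hF hp hσ,
    hα.length_eq hF hp (W.mul_mem hσ (hα.reflection_mem j))]
  rcases lt_or_gt_of_ne (hα.inner_map_ne_zero hF hp j hσ) with h | h
  · have := hα.card_inversions_of_neg hF hp j h
    simp only [Finset.mem_univ, true_and, h, iff_true]
    omega
  · have := hα.card_inversions_mul hF hp j h
    simp only [Finset.mem_univ, true_and, not_lt.2 h.le, iff_false]
    omega

/-- Every point lies in the image of the fundamental domain without its descent walls under
exactly one group element. -/
lemma existsUnique_mem (hα : IsSimpleSystem W F α) (hF : IsFundamentalDomain W F) (x : V) :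
    ∃! σ : W, (σ⁻¹ : W).1 x ∈ F ∧
      ∀ j ∈ rightDescents (fun j => reflectionAt (α j)) (σ : V ≃ₗᵢ[ℝ] V),
        ⟪α j, (σ⁻¹ : W).1 x⟫_ℝ ≠ 0 := by
  obtain ⟨p, hp⟩ := hF.interior_nonempty
  obtain ⟨τ, ⟨hτF, hτ⟩⟩ : ∃ τ : W, (τ⁻¹ : W).1 x ∈ F ∧
      ∀ j ∈ rightDescents (fun j => reflectionAt (α j)) (τ : V ≃ₗᵢ[ℝ] V),
        ⟪α j, (τ⁻¹ : W).1 x⟫_ℝ ≠ 0 := by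
    obtain ⟨σ₀, hσ₀, hx⟩ := hF.exists_mem x
    have hne : {σ : W | (σ⁻¹ : W).1 x ∈ F}.Nonempty :=
      ⟨(⟨σ₀, hσ₀⟩ : W)⁻¹, by rw [Set.mem_ofPred_eq, inv_inv]; exact hx⟩
    obtain ⟨τ, hτF, hmin⟩ := Set.exists_min_image _
      (fun σ : W => length (fun j => reflectionAt (α j)) (σ : V ≃ₗᵢ[ℝ] V)) (Set.toFinite _) hne
    -- If `τ⁻¹ x` lay on a descent wall `j`, then `τ s_j` would be a shorter element with the same
    -- property.
    refine ⟨τ, hτF, fun j hj h0 => ?_⟩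
    have h1 := hmin (τ * ⟨_, hα.reflection_mem j⟩) (by
      rw [Set.mem_ofPred_eq, mul_inv_rev]
      change (reflectionAt (α j))⁻¹ ((τ⁻¹ : W).1 x) ∈ F
      rw [reflectionAt_inv, reflectionAt_apply (hα.norm_eq j), h0]
      simpa using hτF)
    exact absurd (Finset.mem_filter.1 hj).2 (not_lt.2 h1)
  -- At a descent the wall form is strictly positive at `σ⁻¹ x` and stays so for small `t`;
  -- elsewhere its slope in `t` is nonnegative.
  have hsmall : ∀ σ : W, (σ⁻¹ : W).1 x ∈ F →
      (∀ j ∈ rightDescents (fun j => reflectionAt (α j)) (σ : V ≃ₗᵢ[ℝ] V),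
        ⟪α j, (σ⁻¹ : W).1 x⟫_ℝ ≠ 0) →
      ∀ᶠ t : ℝ in 𝓝[>] 0, (σ⁻¹ : W).1 (x + t • p) ∈ F := by
    intro σ hσF hσ
    simp only [hα.mem_iff]
    refine eventually_all.2 fun j => ?_
    have hlin : ∀ t : ℝ, ⟪α j, (σ⁻¹ : W).1 (x + t • p)⟫_ℝ =
        ⟪α j, (σ⁻¹ : W).1 x⟫_ℝ + t * ⟪(σ : V ≃ₗᵢ[ℝ] V) (α j), p⟫_ℝ := by
      intro t
      rw [map_add, map_smul, inner_add_right, inner_smul_right]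
      congr 2
      exact inner_inv_apply _ _ _
    simp only [hlin]
    by_cases hj : j ∈ rightDescents (fun j => reflectionAt (α j)) (σ : V ≃ₗᵢ[ℝ] V)
    · have h0 : 0 < ⟪α j, (σ⁻¹ : W).1 x⟫_ℝ :=
        lt_of_le_of_ne ((hα.mem_iff _).1 hσF j) (hσ j hj).symm
      have hc : Tendsto (fun t : ℝ => ⟪α j, (σ⁻¹ : W).1 x⟫_ℝ +
          t * ⟪(σ : V ≃ₗᵢ[ℝ] V) (α j), p⟫_ℝ) (𝓝[>] 0) (𝓝 ⟪α j, (σ⁻¹ : W).1 x⟫_ℝ) := by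
        have : Continuous fun t : ℝ => ⟪α j, (σ⁻¹ : W).1 x⟫_ℝ +
          t * ⟪(σ : V ≃ₗᵢ[ℝ] V) (α j), p⟫_ℝ := by fun_prop
        simpa using (this.tendsto 0).mono_left nhdsWithin_le_nhds
      exact (hc.eventually (lt_mem_nhds h0)).mono fun t ht => ht.le
    · rw [hα.mem_rightDescents_iff hF hp σ.2, not_lt] at hj
      filter_upwards [self_mem_nhdsWithin] with t ht
      exact add_nonneg ((hα.mem_iff _).1 hσF j) (mul_nonneg (le_of_lt ht) hj)
  refine ⟨τ, ⟨hτF, hτ⟩, ?_⟩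
  rintro σ ⟨hσF, hσ⟩
  obtain ⟨t, ⟨h1, h2⟩, ht⟩ :=
    (((hsmall σ hσF hσ).and (hsmall τ hτF hτ)).and self_mem_nhdsWithin).exists
  -- An orbit meets `F` once, so `σ⁻¹` and `τ⁻¹` agree at `x` and at `x + t p`, hence at `p`, whose
  -- stabilizer is trivial.
  have e1 := hF.apply_eq_apply (σ⁻¹).2 (τ⁻¹).2 h1 h2
  have e2 := hF.apply_eq_apply (σ⁻¹).2 (τ⁻¹).2 hσF hτF
  rw [map_add, map_add, e2, map_smul, map_smul] at e1
  have e3 := smul_right_injective V (ne_of_gt ht : t ≠ 0) (add_left_cancel e1)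
  have e4 : (τ * σ⁻¹ : W).1 p = p := by
    change τ.1 ((σ⁻¹ : W).1 p) = p
    have e3' : (σ⁻¹ : W).1 p = (τ⁻¹ : W).1 p := e3
    rw [e3']
    exact τ.1.apply_symm_apply p
  have e5 : τ * σ⁻¹ = 1 := Subtype.ext (hF.eq_one_of_apply_eq hp (τ * σ⁻¹).2 e4)
  exact (mul_inv_eq_one.1 e5).symm

end IsSimpleSystem

end SymCone

/-! ### The wall normals form a simple system -/

namespace SymCone

variable {V : Type*} [NormedAddCommGroup V] [InnerProductSpace ℝ V]
  {W : Subgroup (V ≃ₗᵢ[ℝ] V)} [Finite W] {F : Set V}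

/-- Some `σ ≠ 1` gives equality in the Dirichlet inequality at the wall point `q`. Then `p - σ p` is
nonnegative on `F` and zero at `q`, hence a multiple of `β`. So `σ` acts on `p` and on the wall as
the reflection does, and these span. -/
lemma IsFundamentalDomain.reflectionAt_mem {κ : Type*} [Fintype κ] [DecidableEq κ]
    (hF : IsFundamentalDomain W F) (B : Module.Basis κ ℝ V) {o : κ}
    (hFB : ∀ x, x ∈ F ↔ ∀ i, i ≠ o → 0 ≤ B.repr x i) {k : κ} (hk : k ≠ o) {β : V}
    (hβ : ‖β‖ = 1) {q : V} (hqF : q ∈ F) (hqk : B.repr q k = 0)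
    (hβB : ∀ i, i ≠ k → ⟪β, B i⟫_ℝ = 0)
    (hq : ∀ γ, (∀ x ∈ F, 0 ≤ ⟪γ, x⟫_ℝ) → ⟪γ, q⟫_ℝ = 0 → ∃ c : ℝ, 0 ≤ c ∧ γ = c • β) :
    reflectionAt β ∈ W := by
  obtain ⟨p, hp⟩ := hF.interior_nonempty
  have hpF := interior_subset hp
  obtain ⟨σ, hσ, hσ1, hσq⟩ : ∃ σ ∈ W, σ ≠ 1 ∧ ⟪q, σ p⟫_ℝ = ⟪q, p⟫_ℝ := by
    by_contra! hne
    -- If all inequalities were strict at `q`, they would persist at `q - t B k`, which lies outside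
    -- `F`.
    have hlt : ∀ σ : W, (σ : V ≃ₗᵢ[ℝ] V) ≠ 1 → ∀ᶠ t : ℝ in 𝓝[>] 0,
        ⟪q - t • B k, (σ : V ≃ₗᵢ[ℝ] V) p⟫_ℝ < ⟪q - t • B k, p⟫_ℝ := by
      intro σ hσ1
      have h0 := lt_of_le_of_ne (hF.inner_apply_le σ.2 hqF hpF) (hne σ σ.2 hσ1)
      have c1 : Continuous fun t : ℝ => ⟪q - t • B k, (σ : V ≃ₗᵢ[ℝ] V) p⟫_ℝ := by fun_prop
      have c2 : Continuous fun t : ℝ => ⟪q - t • B k, p⟫_ℝ := by fun_prop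
      refine Filter.Eventually.filter_mono nhdsWithin_le_nhds ?_
      exact (c1.tendsto 0).eventually_lt (c2.tendsto 0) (by simpa using h0)
    have hall : ∀ᶠ t : ℝ in 𝓝[>] 0, ∀ σ : W, (σ : V ≃ₗᵢ[ℝ] V) ≠ 1 →
        ⟪q - t • B k, (σ : V ≃ₗᵢ[ℝ] V) p⟫_ℝ < ⟪q - t • B k, p⟫_ℝ := by
      refine eventually_all.2 fun σ => ?_
      by_cases hσ1 : (σ : V ≃ₗᵢ[ℝ] V) = 1
      · exact Eventually.of_forall fun t h => absurd hσ1 h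
      · exact (hlt σ hσ1).mono fun t ht _ => ht
    obtain ⟨t, ht, ht0⟩ := (hall.and self_mem_nhdsWithin).exists
    have h1 := (hFB _).1 (hF.mem_of_inner_lt hp fun σ hσ h => ht ⟨σ, hσ⟩ h) k hk
    rw [map_sub, map_smul, B.repr_self, Finsupp.sub_apply, hqk, Finsupp.smul_apply,
      Finsupp.single_eq_same, smul_eq_mul, mul_one, zero_sub] at h1
    have ht0' : (0 : ℝ) < t := ht0
    linarith
  obtain ⟨c, -, hc⟩ := hq (p - σ p)
    (fun x hx => by
      rw [inner_sub_left, real_inner_comm, real_inner_comm x]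
      exact sub_nonneg.2 (hF.inner_apply_le hσ hx hpF))
    (by rw [inner_sub_left, real_inner_comm, real_inner_comm q, hσq, sub_self])
  have hσp : σ p = p - c • β := by rw [← hc, sub_sub_cancel]
  have hσp' : σ p = reflectionAt β p := by
    have hc0 : c ≠ 0 := by
      rintro rfl
      rw [zero_smul, sub_zero] at hσp
      exact hσ1 (hF.eq_one_of_apply_eq hp hσ hσp)
    -- Since `σ` preserves norms and `c ≠ 0`, necessarily `c = 2⟪β, p⟫`, as for the reflection.
    have h1 : ‖p - c • β‖ ^ 2 = ‖p‖ ^ 2 := by rw [← hσp, σ.norm_map]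
    rw [norm_sub_sq_real, norm_smul, hβ, mul_one, inner_smul_right, Real.norm_eq_abs,
      sq_abs, real_inner_comm] at h1
    have h2 : c * (c - 2 * ⟪β, p⟫_ℝ) = 0 := by linarith
    rw [reflectionAt_apply hβ, ← sub_eq_zero.1 ((mul_eq_zero.1 h2).resolve_left hc0), hσp]
  have hfixB : ∀ i, i ≠ k → σ (B i) = reflectionAt β (B i) := by
    intro i hi
    have h1 : reflectionAt β (B i) = B i := by
      rw [reflectionAt_apply hβ, hβB i hi]; simp
    rw [h1]
    refine hF.apply_eq_self_of_inner_eq hp (basis_mem_of_mem_iff B hFB i) hσ ?_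
    rw [hσp, inner_sub_right, inner_smul_right, real_inner_comm β (B i), hβB i hi, mul_zero,
      sub_zero]
  have hpk : B.repr p k ≠ 0 := by
    intro h0
    have h1 : ⟪β, p⟫_ℝ = 0 := by
      conv_lhs => rw [← B.sum_repr p]
      rw [inner_sum]
      refine Finset.sum_eq_zero fun i _ => ?_
      by_cases hi : i = k
      · rw [hi, h0, zero_smul, inner_zero_right]
      · rw [inner_smul_right, hβB i hi, mul_zero]
    refine hσ1 (hF.eq_one_of_apply_eq hp hσ ?_)
    rw [hσp', reflectionAt_apply hβ, h1]
    simp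
  have hBk : σ (B k) = reflectionAt β (B k) := by
    have h1 : ∀ τ : V ≃ₗᵢ[ℝ] V, τ p = B.repr p k • τ (B k) +
        ∑ i ∈ Finset.univ.erase k, B.repr p i • τ (B i) := by
      intro τ
      conv_lhs => rw [← B.sum_repr p]
      rw [map_sum, ← Finset.add_sum_erase _ _ (Finset.mem_univ k)]
      simp only [map_smul]
    have h2 := hσp'
    rw [h1, h1 (reflectionAt β), Finset.sum_congr rfl fun i hi => by
      rw [hfixB i (Finset.ne_of_mem_erase hi)]] at h2
    exact smul_right_injective V hpk (add_right_cancel h2)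
  have : σ = reflectionAt β := by
    ext x
    rw [← B.sum_repr x]
    simp only [map_sum, map_smul]
    refine Finset.sum_congr rfl fun i _ => ?_
    congr 1
    by_cases hi : i = k
    · rw [hi, hBk]
    · exact hfixB i hi
  exact this ▸ hσ

lemma exists_isSimpleSystem [FiniteDimensional ℝ V] {r : ℕ} (hF : IsFundamentalDomain W F)
    (B : Module.Basis (Fin (r + 1)) ℝ V)
    (hFB : ∀ x, x ∈ F ↔ ∀ i, i ≠ Fin.last r → 0 ≤ B.repr x i) :
    ∃ α : Fin r → V, IsSimpleSystem W F α ∧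
      ∀ j, ∃ c : ℝ, 0 < c ∧ ∀ x, ⟪α j, x⟫_ℝ = c * B.repr x j.castSucc := by
  classical
  have ha : ∀ i, ∃ a : V, ∀ x, ⟪a, x⟫_ℝ = B.repr x i := fun i =>
    ⟨(InnerProductSpace.toDual ℝ V).symm (LinearMap.toContinuousLinearMap (B.coord i)),
      fun x => by rw [InnerProductSpace.toDual_symm_apply]; rfl⟩
  choose a ha using ha
  have ha0 : ∀ i, 0 < ‖a i‖ := by
    intro i
    refine norm_pos_iff.2 fun h => ?_
    have := ha i (B i)
    rw [h, B.repr_self] at this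
    simp at this
  have hα : ∀ i x, ⟪‖a i‖⁻¹ • a i, x⟫_ℝ = ‖a i‖⁻¹ * B.repr x i := fun i x => by
    rw [inner_smul_left, ha]; rfl
  have hne : ∀ j : Fin r, j.castSucc ≠ Fin.last r := fun j => (Fin.castSucc_lt_last j).ne
  have hnorm : ∀ i, ‖‖a i‖⁻¹ • a i‖ = 1 := fun i => by
    rw [norm_smul, norm_inv, norm_norm, inv_mul_cancel₀ (ha0 i).ne']
  have hwall : ∀ k, ∃ q ∈ F, B.repr q k = 0 ∧ ∀ β, (∀ x ∈ F, 0 ≤ ⟪β, x⟫_ℝ) → ⟪β, q⟫_ℝ = 0 →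
      ∃ c : ℝ, 0 ≤ c ∧ β = c • (‖a k‖⁻¹ • a k) := by
    intro k
    have hr : ∀ i, B.repr (∑ i ∈ Finset.univ.erase k, B i) i = if i = k then 0 else 1 := by
      intro i
      rw [map_sum, Finsupp.finsetSum_apply]
      simp only [B.repr_self, Finsupp.single_apply]
      rw [Finset.sum_ite_eq']
      simp
    -- The sum of the other basis vectors is relatively interior to the wall: a form nonnegative on
    -- `F` and zero at this sum kills each of them.
    refine ⟨∑ i ∈ Finset.univ.erase k, B i, ?_, ?_, fun β hβ h0 => ?_⟩
    · rw [hFB]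
      intro i _
      rw [hr]
      split_ifs <;> norm_num
    · rw [hr, if_pos rfl]
    · rw [inner_sum] at h0
      have h1 := (Finset.sum_eq_zero_iff_of_nonneg fun i _ =>
        hβ _ (basis_mem_of_mem_iff B hFB i)).1 h0
      have h2 : β = ⟪β, B k⟫_ℝ • a k := by
        refine ext_inner_right ℝ fun x => ?_
        rw [inner_smul_left, ha]
        conv_lhs => rw [← B.sum_repr x]
        rw [inner_sum, Finset.sum_eq_single k]
        · rw [inner_smul_right, mul_comm]; rfl
        · intro i _ hi
          rw [inner_smul_right, h1 i (Finset.mem_erase.2 ⟨hi, Finset.mem_univ i⟩), mul_zero]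
        · exact fun h => absurd (Finset.mem_univ k) h
      refine ⟨⟪β, B k⟫_ℝ * ‖a k‖,
        mul_nonneg (hβ _ (basis_mem_of_mem_iff B hFB k)) (norm_nonneg _), ?_⟩
      rw [smul_smul, mul_assoc, mul_inv_cancel₀ (ha0 k).ne', mul_one]
      exact h2
  refine ⟨fun j => ‖a j.castSucc‖⁻¹ • a j.castSucc, ⟨fun j => hnorm _, fun j => ?_, fun x => ?_,
    fun j => ?_⟩, fun j => ⟨_, inv_pos.2 (ha0 j.castSucc), hα _⟩⟩
  · obtain ⟨q, hqF, hqk, hq⟩ := hwall j.castSucc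
    refine hF.reflectionAt_mem B hFB (hne j) (hnorm _) hqF hqk (fun i hi => ?_) hq
    rw [hα, B.repr_self, Finsupp.single_eq_of_ne (Ne.symm hi), mul_zero]
  · rw [hFB]
    constructor
    · intro h j
      rw [hα]
      exact mul_nonneg (inv_nonneg.2 (ha0 _).le) (h _ (hne j))
    · intro h i hi
      obtain ⟨j, rfl⟩ := Fin.exists_castSucc_eq.2 hi
      have := h j
      rw [hα] at this
      exact nonneg_of_mul_nonneg_right this (inv_pos.2 (ha0 _))
  · obtain ⟨q, hqF, hqk, hq⟩ := hwall j.castSucc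
    exact ⟨q, hqF, by rw [hα, hqk, mul_zero], hq⟩

end SymCone

/-! ### Geometric series, meromorphy and monomials -/

lemma hasSum_prod_of_fintype {α β E : Type*} [Fintype α] [AddCommMonoid E] [TopologicalSpace E]
    [ContinuousAdd E] {f : α × β → E} {g : α → E} (h : ∀ a, HasSum (fun b => f (a, b)) (g a)) :
    HasSum f (∑ a, g a) := by
  classical
  have h1 : ∀ a ∈ Finset.univ, HasSum (fun x : α × β => if x.1 = a then f x else 0) (g a) := by
    intro a _
    refine ((Prod.mk_right_injective a).hasSum_iff ?_).1 ?_
    · rintro ⟨a', b⟩ hx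
      refine if_neg ?_
      rintro rfl
      exact hx ⟨b, rfl⟩
    · simpa [Function.comp_def] using h a
  simpa using hasSum_sum h1

lemma hasSum_mul_of_summable_norm {α β : Type*} {f : α → ℂ} {g : β → ℂ} {s t : ℂ}
    (hf : HasSum f s) (hg : HasSum g t) (hf' : Summable fun x => ‖f x‖)
    (hg' : Summable fun x => ‖g x‖) : HasSum (fun x : α × β => f x.1 * g x.2) (s * t) :=
  hf.mul hg (summable_mul_of_summable_norm hf' hg')

/-- The multivariate geometric series. -/
lemma hasSum_prod_geometric {n : ℕ} (z : Fin n → ℂ) (hz : ∀ i, ‖z i‖ < 1) :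
    Summable (fun a : Fin n → ℕ => ‖∏ i, z i ^ a i‖) ∧
    HasSum (fun a : Fin n → ℕ => ∏ i, z i ^ a i) (∏ i, (1 - z i))⁻¹ := by
  induction n with
  | zero => exact ⟨Summable.of_finite, by simp⟩
  | succ n ih =>
    obtain ⟨ih1, ih2⟩ := ih (fun i : Fin n => z i.succ) fun i => hz _
    have h0 : Summable fun k : ℕ => ‖z 0 ^ k‖ := by
      simpa only [norm_pow] using
        summable_geometric_of_lt_one (norm_nonneg _) (hz 0)
    obtain ⟨E, hE⟩ : ∃ E : ℕ × (Fin n → ℕ) ≃ (Fin (n + 1) → ℕ), ∀ x,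
        ∏ i, z i ^ (E x) i = z 0 ^ x.1 * ∏ i : Fin n, z i.succ ^ x.2 i := by
      refine ⟨Fin.consEquiv fun _ => ℕ, fun x => ?_⟩
      rw [Fin.prod_univ_succ]
      simp [Fin.consEquiv]
    constructor
    · rw [← E.summable_iff]
      simp only [Function.comp_def, hE]
      exact Summable.mul_norm (f := fun k : ℕ => z 0 ^ k)
        (g := fun a : Fin n → ℕ => ∏ i : Fin n, z i.succ ^ a i) h0 ih1
    · rw [← E.hasSum_iff, Fin.prod_univ_succ, mul_inv]
      simp only [Function.comp_def, hE]
      have h1 : HasSum (fun k : ℕ => z 0 ^ k) (1 - z 0)⁻¹ :=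
        hasSum_geometric_of_norm_lt_one (hz 0)
      have h2 := hasSum_mul_of_summable_norm h1 ih2 h0 ih1
      convert h2 using 1

namespace SymCone

lemma isMeromorphic_sum_div {E : Type*} [NormedAddCommGroup E] [NormedSpace ℂ E] {s : Type*}
    [Fintype s] {N D : s → E → ℂ} (hN : ∀ i, AnalyticOnNhd ℂ (N i) univ)
    (hD : ∀ i, AnalyticOnNhd ℂ (D i) univ) (hd : Dense {y | ∀ i, D i y ≠ 0}) :
    IsMeromorphic fun y => ∑ i, N i y / D i y := by
  classical
  intro x
  refine ⟨univ, isOpen_univ, mem_univ x,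
    fun y => ∑ i, N i y * ∏ k ∈ Finset.univ.erase i, D k y, fun y => ∏ i, D i y, ?_, ?_, ?_, ?_⟩
  · exact Finset.analyticOnNhd_fun_sum _ fun i _ =>
      (hN i).mul (Finset.analyticOnNhd_fun_prod _ fun k _ => hD k)
  · exact Finset.analyticOnNhd_fun_prod _ fun k _ => hD k
  · refine fun y _ => closure_mono ?_ (hd y)
    exact fun y hy => ⟨mem_univ y, Finset.prod_ne_zero_iff.2 fun i _ => hy i⟩
  · intro y _ hy
    have h := Finset.prod_ne_zero_iff.1 hy
    change _ = (∑ i, N i y * ∏ k ∈ Finset.univ.erase i, D k y) / ∏ i, D i y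
    rw [Finset.sum_div]
    refine Finset.sum_congr rfl fun i hi => ?_
    rw [← Finset.mul_prod_erase _ _ hi,
      mul_div_mul_right _ _ (Finset.prod_ne_zero_iff.2 fun k _ => h k (Finset.mem_univ k))]

variable {V : Type*} [NormedAddCommGroup V] [InnerProductSpace ℝ V]

lemma analyticOnNhd_exp_neg_apply (v : V) :
    AnalyticOnNhd ℂ (fun φ : V →L[ℝ] ℂ => Complex.exp (-φ v)) univ := by
  let ev : (V →L[ℝ] ℂ) →L[ℂ] ℂ :=
    { toFun := fun φ => φ v
      map_add' := fun _ _ => rfl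
      map_smul' := fun _ _ => rfl
      cont := by fun_prop }
  exact ((ev.analyticOnNhd univ).neg).cexp

/-- Along the real line `φ + t Ψ`, the `i`-th factor can vanish only where the real part of its
exponent does, that is for a single `t`. -/
lemma dense_one_sub_exp_ne_zero {s : Type*} [Finite s] (v : s → V) (Ψ : V →L[ℝ] ℂ)
    (hΨ : ∀ i, 0 < (Ψ (v i)).re) :
    Dense {φ : V →L[ℝ] ℂ | ∀ i, 1 - Complex.exp (-φ (v i)) ≠ 0} := by
  intro φ
  have hc : Tendsto (fun t : ℝ => φ + t • Ψ) (𝓝[≠] 0) (𝓝 φ) := by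
    have : Continuous fun t : ℝ => φ + t • Ψ := by fun_prop
    have h0 : φ + (0 : ℝ) • Ψ = φ := by ext; simp
    have h1 := this.tendsto 0
    rw [h0] at h1
    exact h1.mono_left nhdsWithin_le_nhds
  refine mem_closure_of_tendsto hc (eventually_all.2 fun i => ?_)
  have h1 : ∀ᶠ t : ℝ in 𝓝[≠] 0, t ≠ -(φ (v i)).re / (Ψ (v i)).re := by
    by_cases h : -(φ (v i)).re / (Ψ (v i)).re = 0
    · rw [h]; exact self_mem_nhdsWithin
    · exact (eventually_ne_nhds (Ne.symm h)).filter_mono nhdsWithin_le_nhds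
  filter_upwards [h1] with t ht h0
  refine ht ?_
  rw [eq_div_iff (hΨ i).ne']
  have h2 := congrArg norm (sub_eq_zero.1 h0).symm
  rw [Complex.norm_exp, norm_one, Real.exp_eq_one_iff] at h2
  simp at h2
  linarith

lemma monomial_eq {Γ : Submodule ℤ V} {ι : Type*} [Fintype ι] (e : Module.Basis ι ℤ Γ) (a : Γ)
    (φ : V →L[ℝ] ℂ) : monomial e a φ = Complex.exp (-φ (a : V)) := by
  have h : (a : V) = ∑ i, e.repr a i • (e i : V) := by
    conv_lhs => rw [← e.sum_repr a]
    simp only [Submodule.coe_sum, Submodule.coe_smul]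
  rw [h, map_sum, ← Finset.sum_neg_distrib, Complex.exp_sum, monomial]
  refine Finset.prod_congr rfl fun i _ => ?_
  rw [coord, ← Complex.exp_int_mul, map_zsmul, zsmul_eq_mul, mul_neg]

end SymCone

/-! ### Positivity on the cone, decomposition of its lattice points, summation -/

namespace SymCone

variable {V : Type*} [NormedAddCommGroup V] [InnerProductSpace ℝ V]

/-- A monoconditional cone is strictly positive for some invariant linear form. -/
lemma exists_invariant_pos {W : Subgroup (V ≃ₗᵢ[ℝ] V)} [Fintype W] {V₁ V₂ : Submodule ℝ V}
    (hV : IsAlmostIrreducible W V₁ V₂) {φ : Module.Dual ℝ V} (h₁ : ¬ V₁ ≤ LinearMap.ker φ)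
    (h₂ : ¬ V₂ ≤ LinearMap.ker φ) :
    ∃ Φ : Module.Dual ℝ V, (∀ σ ∈ W, ∀ x, Φ (σ x) = Φ x) ∧
      ∀ x, (∀ σ ∈ W, 0 ≤ φ (σ x)) → x ≠ 0 → 0 < Φ x := by
  have hsum : ∀ τ : W, ∀ x, ∑ σ : W, (σ : V ≃ₗᵢ[ℝ] V) ((τ : V ≃ₗᵢ[ℝ] V) x) =
      ∑ σ : W, (σ : V ≃ₗᵢ[ℝ] V) x := fun τ x =>
    Equiv.sum_comp (Equiv.mulRight τ) fun σ : W => (σ : V ≃ₗᵢ[ℝ] V) x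
  let Φ : Module.Dual ℝ V :=
    ∑ σ : W, φ ∘ₗ ((σ : V ≃ₗᵢ[ℝ] V).toLinearEquiv : V →ₗ[ℝ] V)
  have hΦ : ∀ x, Φ x = ∑ σ : W, φ ((σ : V ≃ₗᵢ[ℝ] V) x) := fun x => by
    simp [Φ]
  refine ⟨Φ, fun τ hτ x => ?_, fun x hx hx0 => ?_⟩
  · rw [hΦ, hΦ, ← map_sum, ← map_sum, hsum ⟨τ, hτ⟩]
  · rw [hΦ]
    refine lt_of_le_of_ne (Finset.sum_nonneg fun σ _ => hx σ σ.2) fun h0 => hx0 ?_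
    have hz := (Finset.sum_eq_zero_iff_of_nonneg fun (σ : W) _ => hx σ σ.2).1 h0.symm
    have hmeanV₂ : ∑ σ : W, (σ : V ≃ₗᵢ[ℝ] V) x ∈ V₂ := by
      refine hV.mem_of_fixed fun τ hτ => ?_
      rw [map_sum]
      exact Equiv.sum_comp (Equiv.mulLeft (⟨τ, hτ⟩ : W)) fun σ : W => (σ : V ≃ₗᵢ[ℝ] V) x
    -- The orbit sum lies on the line `V₂`, where the form `φ` is injective, and `φ` vanishes on it.
    have hmean : ∑ σ : W, (σ : V ≃ₗᵢ[ℝ] V) x = 0 := by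
      obtain ⟨v, hv, hne⟩ := SetLike.not_le_iff_exists.1 h₂
      have hv0 : (⟨v, hv⟩ : V₂) ≠ 0 := by
        intro h
        have : v = 0 := congrArg Subtype.val h
        simp [this] at hne
      obtain ⟨c, hc⟩ := (finrank_eq_one_iff_of_nonzero' _ hv0).1 hV.finrank_eq_one ⟨_, hmeanV₂⟩
      have hc' : c • v = ∑ σ : W, (σ : V ≃ₗᵢ[ℝ] V) x := congrArg Subtype.val hc
      have h3 := congrArg φ hc'
      rw [map_smul, map_sum, ← h0, smul_eq_mul] at h3
      rw [← hc', (mul_eq_zero.1 h3).resolve_right hne, zero_smul]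
    obtain ⟨y, hy, z, hz', rfl⟩ := Submodule.mem_sup.1
      (hV.isCompl.sup_eq_top ▸ Submodule.mem_top : x ∈ V₁ ⊔ V₂)
    have hz0 : z = 0 := by
      have e1 : ∑ σ : W, (σ : V ≃ₗᵢ[ℝ] V) y + (Fintype.card W : ℝ) • z = 0 := by
        rw [← hmean]
        simp only [map_add, Finset.sum_add_distrib]
        congr 1
        rw [Finset.sum_congr rfl fun (σ : W) _ => hV.trivial σ σ.2 z hz', Finset.sum_const,
          Finset.card_univ, Nat.cast_smul_eq_nsmul]
      have e2 : (Fintype.card W : ℝ) • z ∈ V₁ := by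
        rw [eq_neg_of_add_eq_zero_right e1]
        exact V₁.neg_mem (V₁.sum_mem fun σ _ => hV.invariant σ σ.2 y hy)
      have e3 : z ∈ V₁ := (V₁.smul_mem_iff (Nat.cast_ne_zero.2 Fintype.card_ne_zero)).1 e2
      exact (Submodule.disjoint_def.1 hV.isCompl.disjoint) z e3 hz'
    subst hz0
    rw [add_zero] at hz ⊢
    -- Now `x` lies in `V₁`, in the largest invariant subspace of `V₁` on which `φ` vanishes. By
    -- irreducibility this is zero, as `φ` does not vanish on `V₁`.
    obtain ⟨U, hU⟩ : ∃ U : Submodule ℝ V, ∀ u, u ∈ U ↔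
        u ∈ V₁ ∧ ∀ σ : W, φ ((σ : V ≃ₗᵢ[ℝ] V) u) = 0 :=
      ⟨V₁ ⊓ ⨅ σ : W, LinearMap.ker (φ ∘ₗ ((σ : V ≃ₗᵢ[ℝ] V).toLinearEquiv : V →ₗ[ℝ] V)),
        fun u => by simp [Submodule.mem_iInf]⟩
    have hbot := (hV.irreducible U (fun u hu => ((hU u).1 hu).1) fun τ hτ u hu => ?_).resolve_right fun h => ?_
    · have : y ∈ (⊥ : Submodule ℝ V) := by
        rw [← hbot, hU]
        exact ⟨hy, fun σ => hz σ (Finset.mem_univ σ)⟩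
      exact (Submodule.mem_bot ℝ).1 this
    · rw [hU] at hu ⊢
      exact ⟨hV.invariant τ hτ u hu.1, fun σ => hu.2 (σ * (⟨τ, hτ⟩ : W))⟩
    · refine h₁ fun u hu => ?_
      rw [← h, hU] at hu
      exact hu.2 1

section Decomposition

variable {W : Subgroup (V ≃ₗᵢ[ℝ] V)} {C F : Set V} {Γ : Submodule ℤ V} {r : ℕ}

/-- The indicator of the descents of `σ`, extended by zero. -/
noncomputable def descentVector (s : Fin r → V ≃ₗᵢ[ℝ] V) (σ : V ≃ₗᵢ[ℝ] V) : Fin (r + 1) → ℕ :=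
  Fin.snoc (fun j => if j ∈ rightDescents s σ then 1 else 0) 0

lemma prod_pow_descentVector (s : Fin r → V ≃ₗᵢ[ℝ] V) (σ : V ≃ₗᵢ[ℝ] V) (z : Fin (r + 1) → ℂ) :
    ∏ i, z i ^ descentVector s σ i = ∏ j ∈ rightDescents s σ, z j.castSucc := by
  rw [Fin.prod_univ_castSucc]
  simp only [descentVector, Fin.snoc_castSucc, Fin.snoc_last, pow_zero, mul_one, pow_ite, pow_one]
  rw [Finset.prod_ite_mem, Finset.univ_inter]

/-- The lattice point with natural coordinates `m`. -/
noncomputable def latticePoint {V : Type*} [NormedAddCommGroup V] {Γ : Submodule ℤ V}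
    (b : Module.Basis (Fin (r + 1)) ℤ Γ) (m : Fin (r + 1) → ℕ) : Γ :=
  ∑ i, m i • b i

lemma repr_latticePoint {V : Type*} [NormedAddCommGroup V] {Γ : Submodule ℤ V}
    (b : Module.Basis (Fin (r + 1)) ℤ Γ) (m : Fin (r + 1) → ℕ)
    (i : Fin (r + 1)) : b.repr (latticePoint b m) i = m i := by
  rw [latticePoint]
  simp_rw [← natCast_zsmul]
  rw [Module.Basis.repr_sum_self b fun i => (m i : ℤ)]

lemma exp_neg_latticePoint (b : Module.Basis (Fin (r + 1)) ℤ Γ) (m : Fin (r + 1) → ℕ)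
    (σ : V ≃ₗᵢ[ℝ] V) (φ : V →L[ℝ] ℂ) :
    Complex.exp (-φ (σ (latticePoint b m : V))) =
      ∏ i, Complex.exp (-φ (σ (b i : V))) ^ m i := by
  have h : (latticePoint b m : V) = ∑ i, m i • (b i : V) := by
    rw [latticePoint]
    simp only [Submodule.coe_sum, Submodule.coe_smul_of_tower]
  rw [h, map_sum, map_sum, ← Finset.sum_neg_distrib, Complex.exp_sum]
  refine Finset.prod_congr rfl fun i _ => ?_
  rw [map_nsmul, map_nsmul, ← Complex.exp_nat_mul, nsmul_eq_mul, mul_neg]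

variable [FiniteDimensional ℝ V] [DiscreteTopology Γ] [IsZLattice ℝ Γ] [Finite W] {α : Fin r → V}

/-- The decomposition of the lattice points of a symmetric cone into translates of free monoids,
one for every group element. -/
lemma bijective_decomposition (hF : IsFundamentalDomain W F) (hα : IsSimpleSystem W F α)
    (hC : ∀ σ ∈ W, ∀ x ∈ C, σ x ∈ C) (hΓ : ∀ σ ∈ W, ∀ x ∈ Γ, σ x ∈ Γ)
    (b : Module.Basis (Fin (r + 1)) ℤ Γ) (hK : IsGeneratedBy (C ∩ F) b)
    (hαb : ∀ j, ∃ c : ℝ, 0 < c ∧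
      ∀ x, ⟪α j, x⟫_ℝ = c * (b.ofZLatticeBasis ℝ Γ).repr x j.castSucc) :
    ∃ Θ : W × (Fin (r + 1) → ℕ) ≃ ↥(C ∩ (Γ : Set V)), ∀ x, (Θ x : V) =
      (x.1 : V ≃ₗᵢ[ℝ] V) (latticePoint b fun i =>
        x.2 i + descentVector (fun j => reflectionAt (α j)) (x.1 : V ≃ₗᵢ[ℝ] V) i : V) := by
  rw [isGeneratedBy_iff] at hK
  have hmem : ∀ m, (latticePoint b m : V) ∈ C ∩ F := fun m => (hK _).2 fun i => by
    rw [b.ofZLatticeBasis_repr_apply ℝ Γ, repr_latticePoint]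
    positivity
  set s : Fin r → V ≃ₗᵢ[ℝ] V := fun j => reflectionAt (α j) with hs
  have hinv : ∀ (σ : W) (x : V), (σ⁻¹ : W).1 (σ.1 x) = x := fun σ x => σ.1.symm_apply_apply x
  have hinv' : ∀ (σ : W) (x : V), σ.1 ((σ⁻¹ : W).1 x) = x := fun σ x => σ.1.apply_symm_apply x
  let f : W × (Fin (r + 1) → ℕ) → ↥(C ∩ (Γ : Set V)) := fun x =>
    ⟨x.1.1 (latticePoint b fun i => x.2 i + descentVector s x.1.1 i : V),
      hC _ x.1.2 _ (hmem _).1, hΓ _ x.1.2 _ (Subtype.mem _)⟩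
  have hdom : ∀ (σ : W) (m : Fin (r + 1) → ℕ) (y : V),
      y = (latticePoint b fun i => m i + descentVector s σ.1 i : V) →
      y ∈ F ∧ ∀ j ∈ rightDescents s σ.1, ⟪α j, y⟫_ℝ ≠ 0 := by
    rintro σ m y rfl
    refine ⟨(hmem _).2, fun j hj => ?_⟩
    obtain ⟨c, hc, hcj⟩ := hαb j
    rw [hcj, b.ofZLatticeBasis_repr_apply ℝ Γ, repr_latticePoint, descentVector,
      Fin.snoc_castSucc, if_pos hj]
    push_cast
    positivity
  refine ⟨Equiv.ofBijective f ⟨?_, ?_⟩, fun x => rfl⟩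
  · rintro ⟨σ, m⟩ ⟨τ, n⟩ h
    have hx : σ.1 (latticePoint b fun i => m i + descentVector s σ.1 i : V) =
        τ.1 (latticePoint b fun i => n i + descentVector s τ.1 i : V) := congrArg Subtype.val h
    have hστ : σ = τ := (hα.existsUnique_mem hF _).unique
      (hdom σ m _ (hinv σ _)) (hdom τ n _ (by rw [hx, hinv]))
    subst hστ
    have h1 := Subtype.ext (σ.1.injective hx)
    refine Prod.ext rfl (funext fun i => ?_)
    have h2 := congrArg (fun y => b.repr y i) h1
    simp only [repr_latticePoint] at h2
    have h3 : m i + descentVector s σ.1 i = n i + descentVector s σ.1 i := by exact_mod_cast h2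
    exact Nat.add_right_cancel h3
  · rintro ⟨x, hxC, hxΓ⟩
    obtain ⟨σ, ⟨hσF, hσ⟩, -⟩ := hα.existsUnique_mem hF x
    let y : Γ := ⟨(σ⁻¹ : W).1 x, hΓ _ (σ⁻¹).2 _ hxΓ⟩
    have hy : (y : V) ∈ C ∩ F := ⟨hC _ (σ⁻¹).2 _ hxC, hσF⟩
    have hy0 : ∀ i, 0 ≤ b.repr y i := by
      intro i
      have := (hK _).1 hy i
      rw [b.ofZLatticeBasis_repr_apply ℝ Γ] at this
      exact_mod_cast this
    have hyd : ∀ i, (descentVector s σ.1 i : ℤ) ≤ b.repr y i := by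
      intro i
      induction i using Fin.lastCases with
      | last => simpa [descentVector] using hy0 (Fin.last r)
      | cast j =>
        rw [descentVector, Fin.snoc_castSucc]
        split_ifs with hj
        · refine Int.add_one_le_iff.2 (lt_of_le_of_ne (hy0 _) fun h0 => ?_)
          obtain ⟨c, hc, hcj⟩ := hαb j
          refine hσ j hj ?_
          rw [hcj]
          change c * (b.ofZLatticeBasis ℝ Γ).repr (y : V) j.castSucc = 0
          rw [b.ofZLatticeBasis_repr_apply ℝ Γ, ← h0]
          simp
        · simpa using hy0 j.castSucc
    -- By `hy0` and `hyd` neither `toNat` nor the natural subtraction truncates.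
    refine ⟨⟨σ, fun i => (b.repr y i).toNat - descentVector s σ.1 i⟩, Subtype.ext ?_⟩
    have h1 : (latticePoint b fun i => (b.repr y i).toNat - descentVector s σ.1 i +
        descentVector s σ.1 i) = y := by
      refine b.repr.injective (Finsupp.ext fun i => ?_)
      rw [repr_latticePoint]
      have := hyd i
      have := hy0 i
      omega
    change σ.1 (latticePoint b fun i => (b.repr y i).toNat - descentVector s σ.1 i +
        descentVector s σ.1 i : V) = x
    rw [h1]
    exact hinv' σ x

end Decomposition

/-- The generating function of a symmetric cone with unimodular fundamental part. -/
theorem isGeneratingFunction_sum {W : Subgroup (V ≃ₗᵢ[ℝ] V)} [Fintype W] {C F : Set V}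
    [FiniteDimensional ℝ V] {Γ : Submodule ℤ V} [DiscreteTopology Γ] [IsZLattice ℝ Γ] {r : ℕ} {α : Fin r → V}
    (hF : IsFundamentalDomain W F) (hα : IsSimpleSystem W F α)
    (hC : ∀ σ ∈ W, ∀ x ∈ C, σ x ∈ C) (hΓ : ∀ σ ∈ W, ∀ x ∈ Γ, σ x ∈ Γ)
    (b : Module.Basis (Fin (r + 1)) ℤ Γ) (hK : IsGeneratedBy (C ∩ F) b)
    (hαb : ∀ j, ∃ c : ℝ, 0 < c ∧
      ∀ x, ⟪α j, x⟫_ℝ = c * (b.ofZLatticeBasis ℝ Γ).repr x j.castSucc)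
    {Φ : Module.Dual ℝ V} (hΦ : ∀ σ ∈ W, ∀ i, 0 < Φ (σ (b i : V))) :
    IsGeneratingFunction Γ C fun φ => ∑ σ : W,
      (∏ j ∈ rightDescents (fun j => reflectionAt (α j)) (σ : V ≃ₗᵢ[ℝ] V),
        Complex.exp (-φ ((σ : V ≃ₗᵢ[ℝ] V) (b j.castSucc : V)))) /
      ∏ j, (1 - Complex.exp (-φ ((σ : V ≃ₗᵢ[ℝ] V) (b j : V)))) := by
  let Ψ : V →L[ℝ] ℂ := Complex.ofRealCLM.comp (LinearMap.toContinuousLinearMap Φ)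
  have hΨ : ∀ x : W × Fin (r + 1), 0 < (Ψ ((x.1 : V ≃ₗᵢ[ℝ] V) (b x.2 : V))).re :=
    fun x => hΦ _ x.1.2 _
  constructor
  · have hN : ∀ σ : W, AnalyticOnNhd ℂ (fun φ : V →L[ℝ] ℂ =>
        ∏ j ∈ rightDescents (fun j => reflectionAt (α j)) (σ : V ≃ₗᵢ[ℝ] V),
          Complex.exp (-φ ((σ : V ≃ₗᵢ[ℝ] V) (b j.castSucc : V)))) univ := fun σ =>
      Finset.analyticOnNhd_fun_prod _ fun j _ => analyticOnNhd_exp_neg_apply _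
    have hD : ∀ σ : W, AnalyticOnNhd ℂ (fun φ : V →L[ℝ] ℂ =>
        ∏ j, (1 - Complex.exp (-φ ((σ : V ≃ₗᵢ[ℝ] V) (b j : V))))) univ := fun σ =>
      Finset.analyticOnNhd_fun_prod _ fun j _ =>
        analyticOnNhd_const.sub (analyticOnNhd_exp_neg_apply _)
    have hd := dense_one_sub_exp_ne_zero
      (fun x : W × Fin (r + 1) => (x.1 : V ≃ₗᵢ[ℝ] V) (b x.2 : V)) Ψ hΨ
    refine isMeromorphic_sum_div hN hD (hd.mono ?_)
    intro φ hφ σ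
    exact Finset.prod_ne_zero_iff.2 fun j _ => hφ (σ, j)
  -- On this open set all the monomials `exp (-φ (σ b_i))` have modulus below 1; the complexified
  -- invariant form `Ψ` is a point of it.
  · refine ⟨{φ | ∀ x : W × Fin (r + 1), 0 < (φ ((x.1 : V ≃ₗᵢ[ℝ] V) (b x.2 : V))).re}, ?_,
      ⟨Ψ, hΨ⟩, fun φ hφ => ?_⟩
    · simp only [Set.ofPred_forall]
      refine isOpen_iInter_of_finite fun x => isOpen_lt continuous_const ?_
      exact Complex.continuous_re.comp (by fun_prop)
    · obtain ⟨Θ, hΘ⟩ := bijective_decomposition hF hα hC hΓ b hK hαb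
      rw [← Θ.hasSum_iff]
      refine hasSum_prod_of_fintype fun σ => ?_
      have hz : ∀ i, ‖Complex.exp (-φ ((σ : V ≃ₗᵢ[ℝ] V) (b i : V)))‖ < 1 := by
        intro i
        rw [Complex.norm_exp, Real.exp_lt_one_iff, Complex.neg_re, neg_lt_zero]
        exact hφ (σ, i)
      have h := (hasSum_prod_geometric _ hz).2.mul_left
        (∏ j ∈ rightDescents (fun j => reflectionAt (α j)) (σ : V ≃ₗᵢ[ℝ] V),
          Complex.exp (-φ ((σ : V ≃ₗᵢ[ℝ] V) (b j.castSucc : V))))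
      rw [← div_eq_mul_inv] at h
      have hfun : ∀ m, ((fun x : ↥(C ∩ (Γ : Set V)) => Complex.exp (-φ (x : V))) ∘ Θ) (σ, m) =
          (∏ j ∈ rightDescents (fun j => reflectionAt (α j)) (σ : V ≃ₗᵢ[ℝ] V),
            Complex.exp (-φ ((σ : V ≃ₗᵢ[ℝ] V) (b j.castSucc : V)))) *
          ∏ i, Complex.exp (-φ ((σ : V ≃ₗᵢ[ℝ] V) (b i : V))) ^ m i := by
        intro m
        rw [Function.comp_apply, hΘ, exp_neg_latticePoint]
        simp only [pow_add, Finset.prod_mul_distrib]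
        rw [prod_pow_descentVector, mul_comm]
      rw [funext hfun]
      convert h using 1

end SymCone

end

/-! ### Assembly of the theorem -/

theorem mainTheorem4 {V : Type*} [NormedAddCommGroup V] [InnerProductSpace ℝ V]
    [FiniteDimensional ℝ V]
    -- a finite almost irreducible reflection group
    (W : Subgroup (V ≃ₗᵢ[ℝ] V)) [Fintype W] (hW : SymCone.IsReflectionGroup W)
    (V₁ V₂ : Submodule ℝ V) (hV : SymCone.IsAlmostIrreducible W V₁ V₂)
    -- a monoconditional symmetric cone and a fundamental domain
    (C F : Set V) (hC : SymCone.IsMonoconditional W V₁ V₂ C)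
    (hF : SymCone.IsFundamentalDomain W F)
    -- an enumeration of the facet hyperplanes of the fundamental domain
    (r : ℕ) (H : Fin r → Submodule ℝ V) (hH : Function.Injective H)
    (hHF : Set.range H = {K | SymCone.IsFacetHyperplane F K})
    -- a lattice invariant under the group, for which the intersection is unimodular
    (Γ : Submodule ℤ V) [DiscreteTopology Γ] [IsZLattice ℝ Γ]
    (hΓ : ∀ σ ∈ W, ∀ x ∈ Γ, σ x ∈ Γ)
    (hU : SymCone.IsUnimodular Γ (C ∩ F))
    -- a distinguished basis of the lattice
    {ι : Type*} [Fintype ι] (e : Module.Basis ι ℤ Γ) :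
    -- the enumeration of the primitive generators exists and is unique
    (∃! b : Module.Basis (Fin (r + 1)) ℤ Γ,
      SymCone.IsGeneratedBy (C ∩ F) b ∧ ∀ j : Fin r, (b j.castSucc : V) ∉ H j) ∧
    -- the formula for the generating function
    ∀ b : Module.Basis (Fin (r + 1)) ℤ Γ,
      SymCone.IsGeneratedBy (C ∩ F) b → (∀ j : Fin r, (b j.castSucc : V) ∉ H j) →
      SymCone.IsGeneratingFunction Γ C fun φ =>
        ∑ σ : W,
          (∏ j ∈ SymCone.rightDescents (fun i : Fin r => (H i).reflection)
              (σ : V ≃ₗᵢ[ℝ] V),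
            SymCone.monomial e ⟨(σ : V ≃ₗᵢ[ℝ] V) (b j.castSucc : V),
              hΓ σ σ.2 _ (b j.castSucc).2⟩ φ) /
          ∏ j : Fin (r + 1),
            (1 - SymCone.monomial e ⟨(σ : V ≃ₗᵢ[ℝ] V) (b j : V), hΓ σ σ.2 _ (b j).2⟩ φ) := by
  obtain ⟨φ, h₁, h₂, rfl⟩ := hC
  set C : Set V := {x | ∀ σ ∈ W, 0 ≤ φ (σ x)} with hCdef
  have hCW : ∀ σ ∈ W, ∀ x ∈ C, σ x ∈ C := fun σ hσ x hx τ hτ => hx (τ * σ) (W.mul_mem hτ hσ)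
  have hker : ∀ b : Module.Basis (Fin (r + 1)) ℤ Γ, SymCone.IsGeneratedBy (C ∩ F) b →
      (∀ j : Fin r, (b j.castSucc : V) ∉ H j) →
      (∀ x, x ∈ F ↔ ∀ i, i ≠ Fin.last r → 0 ≤ (b.ofZLatticeBasis ℝ Γ).repr x i) ∧
      ∀ j, H j = LinearMap.ker ((b.ofZLatticeBasis ℝ Γ).coord j.castSucc) := by
    intro b hb hbH
    obtain ⟨o, ho, -⟩ := SymCone.exists_fixed_generator hV hF h₂ _
      ((SymCone.isGeneratedBy_iff b _).1 hb)
    obtain ⟨rfl, hj⟩ := SymCone.eq_last_and_eq_ker_coord _ ho hHF (by simpa using hbH)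
    exact ⟨ho, hj⟩
  constructor
  · obtain ⟨b₀, hb₀⟩ := hU
    obtain ⟨o, ho, -⟩ := SymCone.exists_fixed_generator hV hF h₂ _
      ((SymCone.isGeneratedBy_iff b₀ _).1 hb₀)
    obtain ⟨b, hb, hbH⟩ := SymCone.exists_enumeration b₀ ho hb₀ hH hHF
    refine ⟨b, ⟨hb, hbH⟩, ?_⟩
    rintro b' ⟨hb', hbH'⟩
    exact SymCone.enumeration_unique b' b hb' hb (hker b' hb' hbH').2 (hker b hb hbH).2
  · intro b hb hbH
    obtain ⟨hFb, hHb⟩ := hker b hb hbH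
    obtain ⟨α, hα, hαb⟩ := SymCone.exists_isSimpleSystem hF _ hFb
    -- The wall normal is a positive multiple of the coordinate with kernel `H i`, so both
    -- reflections have the same mirror.
    have hrefl : (fun i : Fin r => (H i).reflection) = fun i => SymCone.reflectionAt (α i) := by
      funext i
      have h : H i = (Submodule.span ℝ {α i})ᗮ := by
        obtain ⟨c, hc, hci⟩ := hαb i
        ext x
        rw [hHb, Submodule.mem_orthogonal_singleton_iff_inner_right, hci, LinearMap.mem_ker,
          mul_eq_zero, or_iff_right hc.ne']
        rfl
      have : ∀ K : Submodule ℝ V, K = (Submodule.span ℝ {α i})ᗮ →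
          K.reflection = SymCone.reflectionAt (α i) := by
        rintro _ rfl
        rfl
      exact this _ h
    obtain ⟨Φ, hΦ, hpos⟩ := SymCone.exists_invariant_pos hV h₁ h₂
    have hbC : ∀ i, (b i : V) ∈ C := fun i => by
      have : (b i : V) ∈ C ∩ F := ((SymCone.isGeneratedBy_iff b _).1 hb _).2 fun k => by
        rw [← b.ofZLatticeBasis_apply ℝ Γ, Module.Basis.repr_self, Finsupp.single_apply]
        split_ifs <;> norm_num
      exact this.1
    have key := SymCone.isGeneratingFunction_sum hF hα hCW hΓ b hb hαb (Φ := Φ)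
      fun σ hσ i => by
        rw [hΦ σ hσ]
        refine hpos _ (hbC i) ?_
        rw [← b.ofZLatticeBasis_apply ℝ Γ]
        exact (b.ofZLatticeBasis ℝ Γ).ne_zero i
    simpa only [SymCone.monomial_eq, hrefl] using key
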